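/- Let $\ell_p^n$ denote $\mathbb R^n$ with the $\ell_p$-norm, $1\le p\le\infty$ (with $1/\infty=0$), and let $X_\pi^n=\ell_p^n\otimes_\pi\ell_q^n\otimes_\pi\ell_r^n$ be the projective tensor product, with norm $\|A\|=\inf\sum_{i}\|x_i\|_p\|y_i\|_q\|z_i\|_r$, the infimum being taken over all finite representations $A=\sum_i x_i\otimes y_i\otimes z_i$. Let $\mathrm{id}:\ell_2^{n^3}\to X_\pi^n$ be the natural identity $(A_{ijk})_{i,j,k=1}^n\mapsto\sum_{i,j,k=1}^n A_{ijk}\,e_i\otimes e_j\otimes e_k$, and let $\|\mathrm{id}\|$ be its operator norm. For all $n\ge1$ and $1\le p\le q\le r\le\infty$, $$\|\mathrm{id}:\ell_2^{n^3}\to X_\pi^n\|\asymp_{p,q,r}\begin{cases} n^{\frac12+\frac1r}, & r\le2,\\ n^{\max\left(\frac1q+\frac1r,\frac12\right)}, & p\le2\le q,\ \frac1p+\frac1q+\frac1r\ge1,\\ n^{\frac1p+\frac1q+\frac1r-\frac12}, & p\le2\le q,\ \frac1p+\frac1q+\frac1r\le1,\\ n^{\max\left(\frac1p+\frac1q+\frac1r,\frac12\right)-\frac12},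 & 2\le p.\end{cases}$$ If $q\le2\le r$, then $$n^{\frac12+\frac1r}\lesssim_{p,q,r}\|\mathrm{id}:\ell_2^{n^3}\to X_\pi^n\|\lesssim n^{\min\left(\frac1q+\frac1r,1\right)}.$$ Here $\lesssim_{p,q,r}$ and $\asymp_{p,q,r}$ denote one-sided and two-sided inequalities up to positive constant factors that depend only on $p,q,r$ (not on $n$), and $\lesssim$ denotes an inequality up to a universal constant factor. -/

import Mathlib

open scoped ENNReal TensorProduct

/-- The real number `1 / p` for an exponent `p ∈ [1, ∞]`, with `1 / ∞ = 0`. -/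
noncomputable def recip (p : ℝ≥0∞) : ℝ := (p⁻¹).toReal

/-- `ℓ_p^n` with real scalars: `ℝ^n` with the `ℓ_p` norm (the maximum norm for `p = ∞`). -/
abbrev EllP (p : ℝ≥0∞) (n : ℕ) : Type := PiLp p (fun _ : Fin n => ℝ)

/-- The three exponents of a three-fold tensor product are all at least `1`. -/
instance factOneLeTriple (p q r : ℝ≥0∞) [hp : Fact (1 ≤ p)] [hq : Fact (1 ≤ q)]
    [hr : Fact (1 ≤ r)] (m : Fin 3) : Fact (1 ≤ ![p, q, r] m) :=
  ⟨by fin_cases m <;> simp [hp.out, hq.out, hr.out]⟩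

/-- The projective tensor product `ℓ_p^n ⊗_π ℓ_q^n ⊗_π ℓ_r^n`: the algebraic tensor product
of the three spaces, with Mathlib's norm on it, which is the projective tensor norm
`‖A‖ = inf ∑_i ‖x_i‖_p ‖y_i‖_q ‖z_i‖_r` over all finite representations
`A = ∑_i x_i ⊗ y_i ⊗ z_i`. -/
abbrev ProjTensor (p q r : ℝ≥0∞) (n : ℕ) : Type :=
  ⨂[ℝ] m : Fin 3, EllP (![p, q, r] m) n

/-- The elementary tensor `e_i ⊗ e_j ⊗ e_k` of standard unit vectors, where
`s = (i, j, k) ∈ {1, …, n}³`. -/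
noncomputable def unitTensor (p q r : ℝ≥0∞) {n : ℕ} (s : Fin 3 → Fin n) :
    ProjTensor p q r n :=
  ⨂ₜ[ℝ] m : Fin 3, (WithLp.toLp (![p, q, r] m) (Pi.single (s m) 1) : EllP (![p, q, r] m) n)

/-- The natural identity, as a linear map: the array `(A_{ijk})` is sent to the tensor
`∑_{i,j,k} A_{ijk} e_i ⊗ e_j ⊗ e_k`. -/
noncomputable def idLinear (p q r : ℝ≥0∞) (n : ℕ) :
    EuclideanSpace ℝ (Fin 3 → Fin n) →ₗ[ℝ] ProjTensor p q r n where
  toFun A := ∑ s : Fin 3 → Fin n, A s • unitTensor p q r s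
  map_add' A B := by simp [add_smul, Finset.sum_add_distrib]
  map_smul' c A := by simp [mul_smul, Finset.smul_sum]

/-- The natural identity `id : ℓ_2^{n³} → ℓ_p^n ⊗_π ℓ_q^n ⊗_π ℓ_r^n` as a bounded operator
(every linear map on a finite-dimensional space is bounded). -/
noncomputable def idOp (p q r : ℝ≥0∞) [Fact (1 ≤ p)] [Fact (1 ≤ q)] [Fact (1 ≤ r)] (n : ℕ) :
    EuclideanSpace ℝ (Fin 3 → Fin n) →L[ℝ] ProjTensor p q r n :=
  LinearMap.toContinuousLinearMap (idLinear p q r n)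

/-! By duality the theorem is about trilinear forms. The dual of the projective tensor product is
the space of bounded trilinear forms, so the norm of the identity is the largest ratio of the
Hilbert-Schmidt norm of an array `T` to the norm of its trilinear form (`norm_idOp_le`,
`le_norm_idOp`). With `a = 1/p`, `b = 1/q`, `c = 1/r`, every case compares these two norms up to a
power of `n`. Balls are described by weights `s` with `|x i| ≤ s i ^ a`. This includes `a = 0`, and
Hölder's inequality becomes the weighted mean inequality.

Upper bounds. There are a few sharp inequalities at special exponents, and `FormBound.change` moves
to them at the cost of a Hölder factor. At `(0, 0, 1/2)` orthogonality of random signs gives `hsNorm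
T ≤ N`. With a single `1/2` one controls each fibre, or each slice if a further exponent is `0`, and
sums over the rest. At `a + b + c = 1/2` the Hardy-Littlewood inequality `FormBound.hsNorm_le`
holds. It combines Khinchin's inequality with test vectors built from the marginals of `T ^ 2`.

Lower bounds. Random signs have Hilbert-Schmidt norm `n ^ (3/2)` and form norm of order `√n` on
Euclidean spaces (`exists_sign_array`). Above exponent `1/2` this is interpolated with the trivial
bound on `ℓ_1` (`FormBound.interpolate`), below it Hölder suffices. The diagonal array and a single
entry settle the remaining ranges. -/

/-- The closed unit ball of `ℓ_{1/a}` on a finite index set, in a form that makes sense for every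
`a ≥ 0`: for `a = 0` it is the unit ball of the maximum norm. -/
def lpBall {ι : Type*} [Fintype ι] (a : ℝ) : Set (ι → ℝ) :=
  {x | ∃ s : ι → ℝ, (∀ i, 0 ≤ s i) ∧ ∑ i, s i ≤ 1 ∧ ∀ i, |x i| ≤ s i ^ a}

/-- The trilinear form with coefficients `T`. -/
def triForm {ι κ μ : Type*} [Fintype ι] [Fintype κ] [Fintype μ] (T : ι → κ → μ → ℝ)
    (x : ι → ℝ) (y : κ → ℝ) (z : μ → ℝ) : ℝ :=
  ∑ i, ∑ j, ∑ k, T i j k * x i * y j * z k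

/-- The trilinear form `T` is bounded by `N` on the product of the unit balls of
`ℓ_{1/a}`, `ℓ_{1/b}` and `ℓ_{1/c}`. -/
def FormBound {ι κ μ : Type*} [Fintype ι] [Fintype κ] [Fintype μ] (a b c : ℝ)
    (T : ι → κ → μ → ℝ) (N : ℝ) : Prop :=
  ∀ x ∈ lpBall a, ∀ y ∈ lpBall b, ∀ z ∈ lpBall c, |triForm T x y z| ≤ N

/-- The Hilbert-Schmidt norm of a three-dimensional array. -/
noncomputable def hsNorm {ι κ μ : Type*} [Fintype ι] [Fintype κ] [Fintype μ]
    (T : ι → κ → μ → ℝ) : ℝ :=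
  √(∑ i, ∑ j, ∑ k, T i j k ^ 2)

/-! ### Unit balls described by weights, and Hölder's inequality. -/

section Ball

variable {ι : Type*} [Fintype ι]

lemma le_one_of_sum_le_one {s : ι → ℝ} (hs : ∀ i, 0 ≤ s i) (h1 : ∑ i, s i ≤ 1) (i : ι) :
    s i ≤ 1 :=
  (Finset.single_le_sum (fun j _ => hs j) (Finset.mem_univ i)).trans h1

lemma zero_mem_lpBall (a : ℝ) : (0 : ι → ℝ) ∈ lpBall a :=
  ⟨0, by simp, by simp, fun i => by simpa using Real.rpow_nonneg le_rfl a⟩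

lemma lpBall_anti {a b : ℝ} (hb : 0 ≤ b) (hab : b ≤ a) :
    (lpBall a : Set (ι → ℝ)) ⊆ lpBall b := by
  rintro x ⟨s, hs, h1, hx⟩
  refine ⟨s, hs, h1, fun i => (hx i).trans ?_⟩
  exact Real.rpow_le_rpow_of_exponent_ge' (hs i) (le_one_of_sum_le_one hs h1 i) hb hab

lemma mul_mem_lpBall {a : ℝ} {x σ : ι → ℝ} (hx : x ∈ lpBall a) (hσ : ∀ i, |σ i| ≤ 1) :
    (fun i => σ i * x i) ∈ lpBall a := by
  obtain ⟨s, hs, h1, hx⟩ := hx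
  refine ⟨s, hs, h1, fun i => ?_⟩
  rw [abs_mul]
  exact (mul_le_of_le_one_left (abs_nonneg _) (hσ i)).trans (hx i)

lemma mem_lpBall_zero {x : ι → ℝ} (hx : ∀ i, |x i| ≤ 1) : x ∈ lpBall 0 :=
  ⟨0, by simp, by simp, by simpa using hx⟩

lemma abs_le_one_of_mem_lpBall {a : ℝ} (ha : 0 ≤ a) {x : ι → ℝ} (hx : x ∈ lpBall a) (i : ι) :
    |x i| ≤ 1 := by
  obtain ⟨s, -, -, hx⟩ := lpBall_anti le_rfl ha hx
  simpa using hx i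

lemma mem_lpBall_half {x : ι → ℝ} (hx : ∑ i, x i ^ 2 ≤ 1) : x ∈ lpBall (1 / 2) :=
  ⟨fun i => x i ^ 2, fun i => sq_nonneg _, hx, fun i => by
    rw [← Real.sqrt_eq_rpow, Real.sqrt_sq_eq_abs]⟩

lemma sum_sq_le_one_of_mem_lpBall_half {x : ι → ℝ} (hx : x ∈ lpBall (1 / 2)) :
    ∑ i, x i ^ 2 ≤ 1 := by
  obtain ⟨s, hs, h1, hx⟩ := hx
  refine (Finset.sum_le_sum fun i _ => ?_).trans h1
  have := hx i
  rw [← Real.sqrt_eq_rpow] at this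
  rw [← sq_abs]
  exact (Real.le_sqrt (abs_nonneg _) (hs i)).1 this

lemma single_mem_lpBall [DecidableEq ι] (a : ℝ) (i : ι) {t : ℝ} (ht : |t| ≤ 1) :
    (Pi.single i t : ι → ℝ) ∈ lpBall a := by
  refine ⟨Pi.single i 1, fun j => ?_, by simp, fun j => ?_⟩
  · by_cases h : j = i
    · subst h; simp
    · simp [h]
  · by_cases h : j = i
    · subst h; simpa using ht
    · simpa [h] using Real.rpow_nonneg le_rfl a

/-- This is Hölder's inequality between two exponents. The new weights mix `s` with the uniform
weights in proportion `θ = b / a`, and the weighted mean inequality bounds `s i ^ b * n ^ (-(a -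
b))` by the `a`-th power of the mixture. -/
lemma smul_mem_lpBall_of_le [Nonempty ι] {a b : ℝ} (hb : 0 ≤ b) (hba : b ≤ a) {x : ι → ℝ}
    (hx : x ∈ lpBall b) :
    (fun i => (Fintype.card ι : ℝ) ^ (-(a - b)) * x i) ∈ lpBall a := by
  rcases hb.eq_or_lt' with rfl | hb'
  · rcases hba.eq_or_lt' with rfl | ha
    · simpa using hx
    have hn : (0 : ℝ) < Fintype.card ι := by exact_mod_cast Fintype.card_pos
    refine ⟨fun _ => (Fintype.card ι : ℝ)⁻¹, fun _ => by positivity, ?_, fun i => ?_⟩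
    · simp
    · rw [abs_mul, abs_of_nonneg (by positivity), Real.inv_rpow hn.le, ← Real.rpow_neg hn.le,
        sub_zero]
      exact mul_le_of_le_one_right (by positivity) (abs_le_one_of_mem_lpBall le_rfl hx i)
  obtain ⟨s, hs, h1, hx⟩ := hx
  have hn : (0 : ℝ) < Fintype.card ι := by exact_mod_cast Fintype.card_pos
  let n : ℝ := Fintype.card ι
  have ha : 0 < a := hb'.trans_le hba
  set θ : ℝ := b / a
  have hθ0 : 0 ≤ θ := by positivity
  have hθ1 : θ ≤ 1 := (div_le_one ha).2 hba
  refine ⟨fun i => θ * s i + (1 - θ) * n⁻¹, fun i => ?_, ?_, fun i => ?_⟩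
  · have := hs i
    have : 0 ≤ 1 - θ := by linarith
    positivity
  · rw [Finset.sum_add_distrib, ← Finset.mul_sum]
    have : ∑ _i : ι, (1 - θ) * n⁻¹ = 1 - θ := by
      simp only [Finset.sum_const, Finset.card_univ, nsmul_eq_mul]
      rw [mul_left_comm, mul_inv_cancel₀ hn.ne', mul_one]
    rw [this]
    nlinarith
  · have hn : 0 < n := hn
    rw [abs_mul, abs_of_nonneg (by positivity)]
    have key := Real.geom_mean_le_arith_mean2_weighted hθ0 (sub_nonneg.2 hθ1) (hs i)
      (inv_nonneg.2 hn.le) (by ring)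
    have h2 := Real.rpow_le_rpow (mul_nonneg (Real.rpow_nonneg (hs i) _)
      (Real.rpow_nonneg (inv_nonneg.2 hn.le) _)) key ha.le
    refine le_trans ?_ h2
    rw [Real.mul_rpow (Real.rpow_nonneg (hs i) _) (Real.rpow_nonneg (inv_nonneg.2 hn.le) _),
      ← Real.rpow_mul (hs i), ← Real.rpow_mul (inv_nonneg.2 hn.le), Real.inv_rpow hn.le,
      ← Real.rpow_neg hn.le, mul_comm]
    have e1 : θ * a = b := div_mul_cancel₀ _ ha.ne'
    have e2 : -((1 - θ) * a) = -(a - b) := by rw [sub_mul, e1]; ring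
    rw [e1, e2]
    exact mul_le_mul_of_nonneg_right (hx i) (by positivity)

lemma smul_mem_lpBall [Nonempty ι] {a b : ℝ} (ha : 0 ≤ a) (hb : 0 ≤ b) {x : ι → ℝ}
    (hx : x ∈ lpBall b) :
    (fun i => (Fintype.card ι : ℝ) ^ (-max (a - b) 0) * x i) ∈ lpBall a := by
  rcases le_total b a with h | h
  · rw [max_eq_left (sub_nonneg.2 h)]
    exact smul_mem_lpBall_of_le hb h hx
  · rw [max_eq_right (sub_nonpos.2 h)]
    simpa using lpBall_anti ha h hx

end Ball

/-! ### Trilinear forms, cyclic symmetry and change of exponents. -/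

section Form

variable {ι κ μ : Type*} [Fintype ι] [Fintype κ] [Fintype μ] {T : ι → κ → μ → ℝ} {a b c N : ℝ}

lemma triForm_smul (T : ι → κ → μ → ℝ) (u v w : ℝ) (x : ι → ℝ) (y : κ → ℝ) (z : μ → ℝ) :
    triForm T (fun i => u * x i) (fun j => v * y j) (fun k => w * z k) =
      u * v * w * triForm T x y z := by
  simp only [triForm, Finset.mul_sum]
  refine Finset.sum_congr rfl fun i _ => Finset.sum_congr rfl fun j _ =>
    Finset.sum_congr rfl fun k _ => by ring

lemma FormBound.nonneg (h : FormBound a b c T N) : 0 ≤ N :=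
  (abs_nonneg _).trans (h 0 (zero_mem_lpBall a) 0 (zero_mem_lpBall b) 0 (zero_mem_lpBall c))

lemma triForm_rotate (T : ι → κ → μ → ℝ) (x : ι → ℝ) (y : κ → ℝ) (z : μ → ℝ) :
    triForm (fun j k i => T i j k) y z x = triForm T x y z := by
  unfold triForm
  rw [Finset.sum_congr rfl fun j _ => Finset.sum_comm, Finset.sum_comm]
  refine Finset.sum_congr rfl fun i _ => Finset.sum_congr rfl fun j _ =>
    Finset.sum_congr rfl fun k _ => by ring

lemma FormBound.rotate (h : FormBound a b c T N) :
    FormBound b c a (fun j k i => T i j k) N := fun y hy z hz x hx => by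
  rw [triForm_rotate]; exact h x hx y hy z hz

lemma sum_rotate (F : ι → κ → μ → ℝ) :
    ∑ j, ∑ k, ∑ i, F i j k = ∑ i, ∑ j, ∑ k, F i j k := by
  rw [Finset.sum_congr rfl fun j _ => Finset.sum_comm, Finset.sum_comm]

lemma hsNorm_rotate (T : ι → κ → μ → ℝ) : hsNorm (fun j k i => T i j k) = hsNorm T := by
  simp only [hsNorm, sum_rotate fun i j k => T i j k ^ 2]

lemma hsNorm_sq (T : ι → κ → μ → ℝ) : hsNorm T ^ 2 = ∑ i, ∑ j, ∑ k, T i j k ^ 2 :=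
  Real.sq_sqrt (Finset.sum_nonneg fun _ _ => Finset.sum_nonneg fun _ _ =>
    Finset.sum_nonneg fun _ _ => sq_nonneg _)

/-- Changing the exponents of the three balls costs a power of the dimension. -/
lemma FormBound.change {n : ℕ} [NeZero n] {T : Fin n → Fin n → Fin n → ℝ} {a' b' c' : ℝ}
    (h : FormBound a b c T N) (ha : 0 ≤ a) (hb : 0 ≤ b) (hc : 0 ≤ c)
    (ha' : 0 ≤ a') (hb' : 0 ≤ b') (hc' : 0 ≤ c') :
    FormBound a' b' c' T
      ((n : ℝ) ^ (max (a - a') 0 + max (b - b') 0 + max (c - c') 0) * N) := by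
  intro x hx y hy z hz
  have hn : (0 : ℝ) < n := by exact_mod_cast Nat.pos_of_neZero n
  have key := h _ (smul_mem_lpBall ha ha' hx) _ (smul_mem_lpBall hb hb' hy) _
    (smul_mem_lpBall hc hc' hz)
  rw [triForm_smul, abs_mul, Fintype.card_fin, abs_of_nonneg (by positivity),
    ← Real.rpow_add hn, ← Real.rpow_add hn] at key
  have e : -max (a - a') 0 + -max (b - b') 0 + -max (c - c') 0 =
      -(max (a - a') 0 + max (b - b') 0 + max (c - c') 0) := by ring
  rw [e, Real.rpow_neg hn.le, inv_mul_le_iff₀ (by positivity)] at key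
  exact key

end Form

/-! ### Duality between the projective norm and trilinear forms. -/

section Bridge

lemma norm_le_one_iff_mem_lpBall (p : ℝ≥0∞) [hp : Fact (1 ≤ p)] {n : ℕ} (x : EllP p n) :
    ‖x‖ ≤ 1 ↔ x.ofLp ∈ lpBall (recip p) := by
  rcases eq_or_ne p ⊤ with rfl | hpt
  · have h0 : recip ⊤ = 0 := by simp [recip]
    rw [h0, PiLp.norm_eq_ciSup]
    constructor
    · intro h
      refine mem_lpBall_zero fun i => le_trans ?_ h
      exact le_ciSup (f := fun i => ‖x i‖) (Set.finite_range _).bddAbove i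
    · intro h
      exact Real.iSup_le (fun i => abs_le_one_of_mem_lpBall le_rfl h i) zero_le_one
  · have hpos : 0 < p.toReal := ENNReal.toReal_pos (by
      have := hp.out; intro h; simp [h] at this) hpt
    have hr : recip p = 1 / p.toReal := by simp [recip, ENNReal.toReal_inv]
    have hnn : 0 ≤ ∑ i, ‖x i‖ ^ p.toReal := Finset.sum_nonneg fun i _ => by positivity
    rw [PiLp.norm_eq_sum hpos, hr]
    constructor
    · intro h
      refine ⟨fun i => ‖x i‖ ^ p.toReal, fun i => by positivity, ?_, fun i => ?_⟩
      · by_contra! hlt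
        exact absurd h (not_le.2 (Real.one_lt_rpow hlt (by positivity)))
      · rw [← Real.rpow_mul (norm_nonneg _), mul_one_div_cancel hpos.ne', Real.rpow_one]
        exact le_rfl
    · rintro ⟨s, hs, h1, hx⟩
      refine Real.rpow_le_one hnn ?_ (by positivity)
      refine (Finset.sum_le_sum fun i _ => ?_).trans h1
      have := Real.rpow_le_rpow (abs_nonneg _) (hx i) hpos.le
      rwa [← Real.rpow_mul (hs i), one_div_mul_cancel hpos.ne', Real.rpow_one] at this

lemma sum_fin_three {n : ℕ} {M : Type*} [AddCommMonoid M] (F : (Fin 3 → Fin n) → M) :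
    ∑ s, F s = ∑ i, ∑ j, ∑ k, F ![i, j, k] := by
  let e : Fin n × Fin n × Fin n ≃ (Fin 3 → Fin n) :=
    { toFun := fun t => ![t.1, t.2.1, t.2.2]
      invFun := fun s => (s 0, s 1, s 2)
      left_inv := fun t => rfl
      right_inv := fun s => by ext m; fin_cases m <;> rfl }
  rw [← e.sum_comp, Fintype.sum_prod_type]
  refine Finset.sum_congr rfl fun i _ => ?_
  rw [Fintype.sum_prod_type]
  rfl

variable (p q r : ℝ≥0∞) {n : ℕ}

/-- The multilinear map on `ℓ_p × ℓ_q × ℓ_r` with coefficients `T`. -/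
noncomputable def triMultilinear (T : Fin n → Fin n → Fin n → ℝ) :
    MultilinearMap ℝ (fun m : Fin 3 => EllP (![p, q, r] m) n) ℝ :=
  ∑ i, ∑ j, ∑ k, T i j k • (MultilinearMap.mkPiAlgebra ℝ (Fin 3) ℝ).compLinearMap
    fun m => (PiLp.proj (𝕜 := ℝ) (![p, q, r] m) (fun _ : Fin n => ℝ) (![i, j, k] m)).toLinearMap

lemma triMultilinear_apply (T : Fin n → Fin n → Fin n → ℝ)
    (V : (m : Fin 3) → EllP (![p, q, r] m) n) :
    triMultilinear p q r T V = triForm T (V 0).ofLp (V 1).ofLp (V 2).ofLp := by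
  simp only [triMultilinear, triForm, sum_apply, smul_apply]
  refine Finset.sum_congr rfl fun i _ => Finset.sum_congr rfl fun j _ =>
    Finset.sum_congr rfl fun k _ => ?_
  simp [Fin.prod_univ_three]
  ring

variable [Fact (1 ≤ p)] [Fact (1 ≤ q)] [Fact (1 ≤ r)]

/-- The coefficients of a linear functional on the tensor product. -/
noncomputable def coeffs (f : ProjTensor p q r n →L[ℝ] ℝ) (i j k : Fin n) : ℝ :=
  f (unitTensor p q r ![i, j, k])

lemma formBound_coeffs (f : ProjTensor p q r n →L[ℝ] ℝ) (hf : ‖f‖ ≤ 1) :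
    FormBound (recip p) (recip q) (recip r) (coeffs p q r f) 1 := by
  intro x hx y hy z hz
  let X : (m : Fin 3) → Fin n → ℝ := ![x, y, z]
  let V : (m : Fin 3) → EllP (![p, q, r] m) n := fun m => WithLp.toLp _ (X m)
  have hV : ∀ m, ‖V m‖ ≤ 1 := by
    intro m
    rw [norm_le_one_iff_mem_lpBall]
    fin_cases m
    exacts [hx, hy, hz]
  have hsum : f (⨂ₜ[ℝ] m, V m) = triForm (coeffs p q r f) x y z := by
    have e : V = fun m => ∑ i, X m i •
        (WithLp.toLp (![p, q, r] m) (Pi.single i 1) : EllP (![p, q, r] m) n) := by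
      funext m
      ext j
      simp [V, Pi.single_apply]
    rw [e, MultilinearMap.map_sum, map_sum, sum_fin_three]
    refine Finset.sum_congr rfl fun i _ => Finset.sum_congr rfl fun j _ =>
      Finset.sum_congr rfl fun k _ => ?_
    rw [MultilinearMap.map_smul_univ, map_smul, Fin.prod_univ_three]
    simp only [coeffs, unitTensor, smul_eq_mul, X]
    simp
    ring
  rw [← hsum, ← Real.norm_eq_abs]
  refine (f.le_opNorm _).trans ?_
  refine mul_le_one₀ hf (norm_nonneg _) ((PiTensorProduct.projectiveSeminorm_tprod_le V).trans ?_)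
  exact Finset.prod_le_one (fun _ _ => norm_nonneg _) fun m _ => hV m

/-- Upper bounds for the operator norm of the identity are Hilbert-Schmidt bounds for
trilinear forms. -/
lemma norm_idOp_le {C : ℝ} (hC : 0 ≤ C)
    (h : ∀ (T : Fin n → Fin n → Fin n → ℝ) (N : ℝ),
      FormBound (recip p) (recip q) (recip r) T N → hsNorm T ≤ C * N) :
    ‖idOp p q r n‖ ≤ C := by
  refine ContinuousLinearMap.opNorm_le_bound _ hC fun A => ?_
  -- A Hahn-Banach functional norming the image of `A` has a coefficient array of form norm at most
  -- `1`. Cauchy-Schwarz against `A` then gives the bound.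
  obtain ⟨f, hf, hfA⟩ := exists_dual_vector'' ℝ (idOp p q r n A)
  have h1 := h _ _ (formBound_coeffs p q r f hf)
  rw [mul_one] at h1
  have h2 : f (idOp p q r n A) = ∑ s, A s * f (unitTensor p q r s) := by
    simp [idOp, idLinear]
  have h3 : ‖idOp p q r n A‖ = ∑ s, A s * f (unitTensor p q r s) := by
    rw [← h2, hfA]; rfl
  rw [h3]
  refine (Real.sum_mul_le_sqrt_mul_sqrt _ _ _).trans ?_
  rw [mul_comm C, EuclideanSpace.norm_eq]
  simp only [Real.norm_eq_abs, sq_abs]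
  refine mul_le_mul_of_nonneg_left ?_ (Real.sqrt_nonneg _)
  rw [sum_fin_three fun s => (f (unitTensor p q r s)) ^ 2]
  exact h1

lemma abs_triForm_le {T : Fin n → Fin n → Fin n → ℝ} {N : ℝ}
    (h : FormBound (recip p) (recip q) (recip r) T N)
    (x : EllP p n) (y : EllP q n) (z : EllP r n) :
    |triForm T x.ofLp y.ofLp z.ofLp| ≤ N * (‖x‖ * ‖y‖ * ‖z‖) := by
  have key : ∀ (s : ℝ≥0∞) [Fact (1 ≤ s)] (v : EllP s n), ∃ u ∈ lpBall (recip s),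
      v.ofLp = fun i => ‖v‖ * u i := by
    intro s _ v
    refine ⟨(‖v‖⁻¹ • v).ofLp, (norm_le_one_iff_mem_lpBall s _).1 ?_, ?_⟩
    · rw [norm_smul, norm_inv, norm_norm]
      exact inv_mul_le_one
    · rcases eq_or_ne v 0 with rfl | hv
      · ext i; simp
      · have := norm_ne_zero_iff.2 hv
        ext i
        simp [this]
  obtain ⟨u, hu, eu⟩ := key p x
  obtain ⟨v, hv, ev⟩ := key q y
  obtain ⟨w, hw, ew⟩ := key r z
  rw [eu, ev, ew, triForm_smul, abs_mul, abs_of_nonneg (by positivity), mul_comm]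
  exact mul_le_mul_of_nonneg_right (h u hu v hv w hw) (by positivity)

/-- Every trilinear form gives a lower bound for the operator norm of the identity. -/
lemma le_norm_idOp {T : Fin n → Fin n → Fin n → ℝ} {N L : ℝ}
    (h : FormBound (recip p) (recip q) (recip r) T N) (hN : 0 < N) (hL : L * N ≤ hsNorm T) :
    L ≤ ‖idOp p q r n‖ := by
  have hnn : 0 ≤ hsNorm T := Real.sqrt_nonneg _
  rcases hnn.eq_or_lt' with h0 | hpos
  · refine le_trans ?_ (ContinuousLinearMap.opNorm_nonneg _)
    by_contra! hlt
    have := mul_pos hlt hN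
    linarith
  let Φ := (triMultilinear p q r T).mkContinuous N fun V => by
    rw [triMultilinear_apply, Real.norm_eq_abs, Fin.prod_univ_three]
    exact abs_triForm_le p q r h (V 0) (V 1) (V 2)
  have hΦ : ‖Φ‖ ≤ N := MultilinearMap.mkContinuous_norm_le _ hN.le _
  -- The array is tested on itself: the functional `Φ` takes the value `hsNorm T ^ 2` at the image
  -- of `T`, while `‖Φ‖ ≤ N`.
  let A : EuclideanSpace ℝ (Fin 3 → Fin n) := WithLp.toLp 2 fun s => T (s 0) (s 1) (s 2)
  have hA : ‖A‖ = hsNorm T := by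
    rw [EuclideanSpace.norm_eq, sum_fin_three]
    simp [A, hsNorm]
  have hlift : PiTensorProduct.lift Φ.toMultilinearMap (idOp p q r n A) = hsNorm T ^ 2 := by
    rw [hsNorm_sq]
    simp only [idOp, LinearMap.coe_toContinuousLinearMap', idLinear, LinearMap.coe_mk,
      AddHom.coe_mk, map_sum, map_smul, unitTensor, PiTensorProduct.lift.tprod]
    rw [sum_fin_three]
    refine Finset.sum_congr rfl fun i _ => Finset.sum_congr rfl fun j _ =>
      Finset.sum_congr rfl fun k _ => ?_
    change T i j k • triMultilinear p q r T _ = _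
    rw [triMultilinear_apply]
    simp [triForm, Pi.single_apply, sq]
  have h1 := PiTensorProduct.norm_eval_le_projectiveSeminorm Φ (idOp p q r n A)
  rw [hlift, Real.norm_eq_abs, abs_of_nonneg (sq_nonneg _)] at h1
  have h2 := (idOp p q r n).le_opNorm A
  rw [hA] at h2
  have h3 : hsNorm T ^ 2 ≤ N * (‖idOp p q r n‖ * hsNorm T) :=
    h1.trans (mul_le_mul hΦ h2 (norm_nonneg _) hN.le)
  have h4 : hsNorm T ≤ N * ‖idOp p q r n‖ := by
    refine le_of_mul_le_mul_right ?_ hpos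
    nlinarith
  refine le_of_mul_le_mul_right ?_ hN
  linarith

end Bridge

/-! ### Random signs and Khinchin's inequality. -/

section Signs

open scoped BigOperators

variable {ι κ : Type*} [Fintype ι] [Fintype κ]

/-- The random sign encoded by a Boolean. -/
def boolSign (b : Bool) : ℝ := if b then 1 else -1

@[simp] lemma boolSign_true : boolSign true = 1 := rfl

@[simp] lemma boolSign_false : boolSign false = -1 := rfl

lemma boolSign_mul_self (b : Bool) : boolSign b * boolSign b = 1 := by
  cases b <;> norm_num

lemma abs_boolSign (b : Bool) : |boolSign b| = 1 := by
  cases b <;> norm_num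

lemma boolSign_not (b : Bool) : boolSign (!b) = -boolSign b := by
  cases b <;> norm_num

variable [DecidableEq ι]

lemma expect_boolSign_mul (i j : ι) :
    𝔼 ε : ι → Bool, boolSign (ε i) * boolSign (ε j) = if i = j then 1 else 0 := by
  split_ifs with h
  · subst h
    simp [boolSign_mul_self]
  -- Flipping the `i`-th sign preserves the average and negates the product, so the average
  -- vanishes.
  · let e : (ι → Bool) ≃ (ι → Bool) :=
      Function.Involutive.toPerm (fun ε => Function.update ε i (!ε i)) fun ε => by
        ext l
        by_cases hl : l = i
        · subst hl; simp
        · simp [hl]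
    have key : 𝔼 ε : ι → Bool, boolSign (ε i) * boolSign (ε j) =
        𝔼 ε : ι → Bool, -(boolSign (ε i) * boolSign (ε j)) := by
      refine Fintype.expect_equiv e _ _ fun ε => ?_
      change _ = -(boolSign (Function.update ε i (!ε i) i) *
        boolSign (Function.update ε i (!ε i) j))
      rw [Function.update_self, Function.update_of_ne (Ne.symm h), boolSign_not]
      ring
    rw [Finset.expect_neg_distrib] at key
    linarith

lemma expect_sq_sum_boolSign (a : ι → ℝ) :
    𝔼 ε : ι → Bool, (∑ i, boolSign (ε i) * a i) ^ 2 = ∑ i, a i ^ 2 := by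
  have h : ∀ ε : ι → Bool, (∑ i, boolSign (ε i) * a i) ^ 2 =
      ∑ i, ∑ j, a i * a j * (boolSign (ε i) * boolSign (ε j)) := fun ε => by
    rw [sq, Finset.sum_mul_sum]
    exact Finset.sum_congr rfl fun i _ => Finset.sum_congr rfl fun j _ => by ring
  rw [Finset.expect_congr rfl fun ε _ => h ε, Finset.expect_sum_comm]
  refine Finset.sum_congr rfl fun i _ => ?_
  rw [Finset.expect_sum_comm]
  simp only [← Finset.mul_expect, expect_boolSign_mul]
  simp [sq]

/-- Random sign sums are subgaussian. -/
lemma expect_exp_sum_boolSign_le (a : ι → ℝ) :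
    𝔼 ε : ι → Bool, Real.exp (∑ i, boolSign (ε i) * a i) ≤ Real.exp ((∑ i, a i ^ 2) / 2) := by
  have h1 : ∑ ε : ι → Bool, Real.exp (∑ i, boolSign (ε i) * a i) =
      ∏ i, (2 * Real.cosh (a i)) := by
    have := Finset.prod_univ_sum (fun _ : ι => (Finset.univ : Finset Bool))
      fun i b => Real.exp (boolSign b * a i)
    rw [Fintype.piFinset_univ] at this
    simp only [Real.exp_sum]
    rw [← this]
    refine Finset.prod_congr rfl fun i _ => ?_
    rw [Fintype.sum_bool, Real.cosh_eq]
    simp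
    ring
  rw [Fintype.expect_eq_sum_div_card, h1, Finset.prod_mul_distrib]
  have h2 : (Fintype.card (ι → Bool) : ℝ) = ∏ _i : ι, (2 : ℝ) := by simp
  rw [h2, mul_div_cancel_left₀ _ (by positivity), Finset.sum_div, Real.exp_sum]
  exact Finset.prod_le_prod (fun i _ => (Real.cosh_pos _).le) fun i _ =>
    Real.cosh_le_exp_half_sq _

/-- The fourth moment is read off from the exponential moments through `s ^ 4 ≤ 4! * exp |s|`. Since
`exp (1/2) ≤ 2`, the constant is `24 * (2 + 2) = 96`. -/
lemma expect_pow_four_sum_boolSign_le {a : ι → ℝ} (ha : ∑ i, a i ^ 2 = 1) :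
    𝔼 ε : ι → Bool, (∑ i, boolSign (ε i) * a i) ^ 4 ≤ 96 := by
  have h1 : ∀ s : ℝ, s ^ 4 ≤ 24 * (Real.exp s + Real.exp (-s)) := fun s => by
    have h := Real.pow_div_factorial_le_exp |s| (abs_nonneg s) 4
    have h4 : |s| ^ 4 = s ^ 4 := Even.pow_abs (by decide) s
    rw [h4] at h
    norm_num [Nat.factorial] at h
    have : Real.exp |s| ≤ Real.exp s + Real.exp (-s) := by
      rcases abs_cases s with ⟨e, -⟩ | ⟨e, -⟩ <;> rw [e]
      · linarith [Real.exp_pos (-s)]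
      · linarith [Real.exp_pos s]
    linarith
  have h2 := expect_exp_sum_boolSign_le a
  have h3 := expect_exp_sum_boolSign_le fun i => -a i
  simp only [neg_sq, mul_neg, Finset.sum_neg_distrib, ha] at h2 h3
  have h5 : Real.exp (1 / 2) ≤ 2 := by
    have : Real.exp (1 / 2) ^ 2 = Real.exp 1 := by
      rw [← Real.exp_nat_mul]; norm_num
    nlinarith [Real.exp_one_lt_d9, Real.exp_pos (1 / 2)]
  calc _ ≤ 𝔼 ε : ι → Bool, 24 * (Real.exp (∑ i, boolSign (ε i) * a i) +
        Real.exp (-∑ i, boolSign (ε i) * a i)) := Finset.expect_le_expect fun ε _ => h1 _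
    _ ≤ 96 := by
      rw [← Finset.mul_expect, Finset.expect_add_distrib]
      linarith

/-- Khinchin's inequality in `L¹`, with a crude constant. -/
lemma sqrt_le_expect_abs (a : ι → ℝ) :
    √(∑ i, a i ^ 2) ≤ 28 * 𝔼 ε : ι → Bool, |∑ i, boolSign (ε i) * a i| := by
  have main : ∀ a : ι → ℝ, ∑ i, a i ^ 2 = 1 →
      1 ≤ 28 * 𝔼 ε : ι → Bool, |∑ i, boolSign (ε i) * a i| := by
    intro a ha
    -- The second moment is split at level `14`: the first term dominates below it, the second
    -- above. The fourth moment contributes at most `96 / 196 < 1 / 2`, so the first term carries at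
    -- least half of the second moment, whence the constant `28`.
    have h1 : ∀ s : ℝ, s ^ 2 ≤ 14 * |s| + (1 / 196) * s ^ 4 := fun s => by
      have hs := abs_nonneg s
      have e2 : s ^ 2 = |s| ^ 2 := (sq_abs s).symm
      have e4 : s ^ 4 = |s| ^ 4 := (Even.pow_abs (by decide) s).symm
      rw [e2, e4]
      rcases le_total |s| 14 with h | h
      · nlinarith [pow_nonneg hs 4]
      · have : 196 ≤ |s| ^ 2 := by nlinarith
        nlinarith [sq_nonneg |s|]
    have h2 := expect_pow_four_sum_boolSign_le ha
    have h3 := expect_sq_sum_boolSign a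
    have h4 : 𝔼 ε : ι → Bool, (∑ i, boolSign (ε i) * a i) ^ 2 ≤
        𝔼 ε : ι → Bool, (14 * |∑ i, boolSign (ε i) * a i| +
          (1 / 196) * (∑ i, boolSign (ε i) * a i) ^ 4) :=
      Finset.expect_le_expect fun ε _ => h1 _
    rw [Finset.expect_add_distrib, ← Finset.mul_expect, ← Finset.mul_expect, h3, ha] at h4
    linarith
  set σ := √(∑ i, a i ^ 2) with hσ
  have hσ0 : 0 ≤ σ := Real.sqrt_nonneg _
  have hσ2 : σ ^ 2 = ∑ i, a i ^ 2 := Real.sq_sqrt (Finset.sum_nonneg fun _ _ => sq_nonneg _)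
  rcases hσ0.eq_or_lt' with h0 | hpos
  · rw [h0]
    exact mul_nonneg (by norm_num) (Finset.expect_nonneg fun _ _ => abs_nonneg _)
  have h := main (fun i => a i / σ) (by
    simp only [div_pow, ← Finset.sum_div, ← hσ2]
    exact div_self (by positivity))
  have e : ∀ ε : ι → Bool, |∑ i, boolSign (ε i) * (a i / σ)| =
      |∑ i, boolSign (ε i) * a i| / σ := fun ε => by
    rw [← abs_of_pos hpos, ← abs_div, Finset.sum_div, abs_of_pos hpos]
    simp only [mul_div_assoc]
  rw [Finset.expect_congr rfl fun ε _ => e ε, ← Finset.expect_div, ← mul_div_assoc,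
    le_div_iff₀ hpos, one_mul] at h
  exact h

variable [DecidableEq κ]

lemma expect_sq_double_sum_boolSign (a : ι → κ → ℝ) :
    𝔼 ε : ι → Bool, 𝔼 δ : κ → Bool,
      (∑ i, ∑ j, boolSign (ε i) * boolSign (δ j) * a i j) ^ 2 = ∑ i, ∑ j, a i j ^ 2 := by
  have h : ∀ (ε : ι → Bool) (δ : κ → Bool),
      ∑ i, ∑ j, boolSign (ε i) * boolSign (δ j) * a i j =
        ∑ j, boolSign (δ j) * ∑ i, boolSign (ε i) * a i j := fun ε δ => by
    rw [Finset.sum_comm]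
    refine Finset.sum_congr rfl fun j _ => ?_
    rw [Finset.mul_sum]
    exact Finset.sum_congr rfl fun i _ => by ring
  simp only [h, expect_sq_sum_boolSign]
  rw [Finset.expect_sum_comm, Finset.sum_comm]
  simp only [expect_sq_sum_boolSign]

/-- Khinchin's inequality in `L¹` for a Rademacher chaos of order two. -/
lemma sqrt_le_expect_expect_abs (a : ι → κ → ℝ) :
    √(∑ i, ∑ j, a i j ^ 2) ≤ 784 * 𝔼 ε : ι → Bool, 𝔼 δ : κ → Bool,
      |∑ i, ∑ j, boolSign (ε i) * boolSign (δ j) * a i j| := by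
  have h : ∀ (ε : ι → Bool) (δ : κ → Bool),
      ∑ i, ∑ j, boolSign (ε i) * boolSign (δ j) * a i j =
        ∑ j, boolSign (δ j) * ∑ i, boolSign (ε i) * a i j := fun ε δ => by
    rw [Finset.sum_comm]
    refine Finset.sum_congr rfl fun j _ => ?_
    rw [Finset.mul_sum]
    exact Finset.sum_congr rfl fun i _ => by ring
  simp only [h]
  set σ := √(∑ i, ∑ j, a i j ^ 2)
  let t : κ → ℝ := fun j => √(∑ i, a i j ^ 2)
  have ht2 : ∀ j, t j ^ 2 = ∑ i, a i j ^ 2 := fun j =>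
    Real.sq_sqrt (Finset.sum_nonneg fun _ _ => sq_nonneg _)
  have hσ2 : σ ^ 2 = ∑ j, t j ^ 2 := by
    simp only [ht2]
    rw [Finset.sum_comm]
    exact Real.sq_sqrt (Finset.sum_nonneg fun _ _ => Finset.sum_nonneg fun _ _ => sq_nonneg _)
  have hσ0 : 0 ≤ σ := Real.sqrt_nonneg _
  rcases hσ0.eq_or_lt' with h0 | hpos
  · rw [h0]
    exact mul_nonneg (by norm_num) (Finset.expect_nonneg fun _ _ =>
      Finset.expect_nonneg fun _ _ => abs_nonneg _)
  -- After multiplication by `σ` the estimate becomes Minkowski's inequality in dual form, with test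
  -- vector `t`. Khinchin is applied first in `ε`, then in `δ`, so the constant is `28 ^ 2 = 784`.
  refine le_of_mul_le_mul_left ?_ hpos
  rw [← sq, hσ2]
  calc ∑ j, t j ^ 2
      ≤ ∑ j, t j * (28 * 𝔼 ε : ι → Bool, |∑ i, boolSign (ε i) * a i j|) := by
        refine Finset.sum_le_sum fun j _ => ?_
        rw [sq]
        exact mul_le_mul_of_nonneg_left (sqrt_le_expect_abs _) (Real.sqrt_nonneg _)
    _ = 28 * 𝔼 ε : ι → Bool, ∑ j, t j * |∑ i, boolSign (ε i) * a i j| := by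
        rw [Finset.expect_sum_comm, Finset.mul_sum]
        refine Finset.sum_congr rfl fun j _ => ?_
        rw [← Finset.mul_expect]
        ring
    _ ≤ 28 * 𝔼 ε : ι → Bool, σ * √(∑ j, (∑ i, boolSign (ε i) * a i j) ^ 2) := by
        refine mul_le_mul_of_nonneg_left (Finset.expect_le_expect fun ε _ => ?_) (by norm_num)
        refine (Real.sum_mul_le_sqrt_mul_sqrt _ _ _).trans_eq ?_
        simp only [sq_abs, ← hσ2, Real.sqrt_sq hσ0]
    _ ≤ 28 * 𝔼 ε : ι → Bool, σ * (28 * 𝔼 δ : κ → Bool,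
          |∑ j, boolSign (δ j) * ∑ i, boolSign (ε i) * a i j|) := by
        refine mul_le_mul_of_nonneg_left (Finset.expect_le_expect fun ε _ => ?_) (by norm_num)
        exact mul_le_mul_of_nonneg_left (sqrt_le_expect_abs _) hσ0
    _ = _ := by
        simp only [← Finset.mul_expect]
        ring

end Signs

/-! ### The trilinear Hardy-Littlewood inequality. -/

section HardyLittlewood

open scoped BigOperators

variable {ι κ μ : Type*} [Fintype ι] [Fintype κ] [Fintype μ] {T : ι → κ → μ → ℝ} {a b c N : ℝ}

lemma triForm_eq (T : ι → κ → μ → ℝ) (x : ι → ℝ) (y : κ → ℝ) (z : μ → ℝ) :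
    triForm T x y z = ∑ k, z k * ∑ i, ∑ j, T i j k * (x i * y j) := by
  simp only [triForm, Finset.mul_sum]
  rw [← sum_rotate, ← sum_rotate]
  refine Finset.sum_congr rfl fun k _ => Finset.sum_congr rfl fun i _ =>
    Finset.sum_congr rfl fun j _ => by ring

lemma FormBound.sum_abs_le (h : FormBound a b c T N) {x : ι → ℝ} (hx : x ∈ lpBall a)
    {y : κ → ℝ} (hy : y ∈ lpBall b) {z : μ → ℝ} (hz : z ∈ lpBall c) :
    ∑ k, |z k| * |∑ i, ∑ j, T i j k * (x i * y j)| ≤ N := by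
  let A : μ → ℝ := fun k => ∑ i, ∑ j, T i j k * (x i * y j)
  -- Adjusting the signs of `z` keeps it in the ball and makes every term of the sum nonnegative.
  have := h x hx y hy _ (mul_mem_lpBall hz
    (σ := fun k => if 0 ≤ z k * A k then 1 else -1) fun k => by
      split_ifs <;> norm_num)
  refine le_trans (le_of_eq ?_) ((le_abs_self _).trans this)
  rw [triForm_eq]
  refine Finset.sum_congr rfl fun k _ => ?_
  rw [← abs_mul]
  change |z k * A k| = (if 0 ≤ z k * A k then 1 else -1) * z k * A k
  split_ifs with hk
  · rw [abs_of_nonneg hk]; ring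
  · rw [abs_of_neg (not_le.1 hk)]; ring

/-- Sign changes of `x` and `y` keep them in their balls, so the previous bound survives averaging
over both. Khinchin for the order-two chaos turns the average into square functions. -/
lemma FormBound.sum_sqrt_le (h : FormBound a b c T N) {x : ι → ℝ} (hx : x ∈ lpBall a)
    {y : κ → ℝ} (hy : y ∈ lpBall b) {z : μ → ℝ} (hz : z ∈ lpBall c) :
    ∑ k, |z k| * √(∑ i, ∑ j, (T i j k * (x i * y j)) ^ 2) ≤ 784 * N := by
  classical
  calc ∑ k, |z k| * √(∑ i, ∑ j, (T i j k * (x i * y j)) ^ 2)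
      ≤ ∑ k, |z k| * (784 * 𝔼 ε : ι → Bool, 𝔼 δ : κ → Bool,
        |∑ i, ∑ j, boolSign (ε i) * boolSign (δ j) * (T i j k * (x i * y j))|) :=
        Finset.sum_le_sum fun k _ => mul_le_mul_of_nonneg_left
          (sqrt_le_expect_expect_abs _) (abs_nonneg _)
    _ = 784 * 𝔼 ε : ι → Bool, 𝔼 δ : κ → Bool, ∑ k, |z k| *
        |∑ i, ∑ j, T i j k * ((boolSign (ε i) * x i) * (boolSign (δ j) * y j))| := by
        simp only [Finset.expect_sum_comm, Finset.mul_sum]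
        refine Finset.sum_congr rfl fun k _ => ?_
        simp only [← Finset.mul_expect]
        rw [mul_left_comm]
        refine congrArg _ (congrArg _ (Finset.expect_congr rfl fun ε _ =>
          Finset.expect_congr rfl fun δ _ => congrArg _ (Finset.sum_congr rfl fun i _ =>
            Finset.sum_congr rfl fun j _ => ?_)))
        ring
    _ ≤ 784 * N := by
        refine mul_le_mul_of_nonneg_left ?_ (by norm_num)
        refine Finset.expect_le Finset.univ_nonempty fun ε _ =>
          Finset.expect_le Finset.univ_nonempty fun δ _ => ?_
        exact h.sum_abs_le (mul_mem_lpBall hx fun i => (abs_boolSign _).le)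
          (mul_mem_lpBall hy fun i => (abs_boolSign _).le) hz

lemma rpow_mem_lpBall {R : ι → ℝ} (hR : ∀ i, 0 ≤ R i) (hR1 : ∑ i, R i ≤ 1) (a : ℝ) :
    (fun i => R i ^ a) ∈ lpBall a :=
  ⟨R, hR, hR1, fun i => by rw [abs_of_nonneg (Real.rpow_nonneg (hR i) a)]⟩

/-- Powers of `R`, `C` and `D` serve as test vectors. Cauchy-Schwarz on the slice with `k` fixed
extracts a factor `√(D k)`, which the exponent `c - 1 / 2` compensates. -/
lemma FormBound.sum_weight_le (h : FormBound a b c T N) {R : ι → ℝ} {C : κ → ℝ} {D : μ → ℝ}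
    (hR : ∀ i, 0 ≤ R i) (hR1 : ∑ i, R i ≤ 1) (hC : ∀ i, 0 ≤ C i) (hC1 : ∑ i, C i ≤ 1)
    (hD : ∀ k, D k = ∑ i, ∑ j, T i j k ^ 2) (hD1 : ∑ k, D k ≤ 1) :
    ∑ i, ∑ j, ∑ k, T i j k ^ 2 * (R i ^ a * C j ^ b * D k ^ (c - 1 / 2)) ≤ 784 * N := by
  have hD0 : ∀ k, 0 ≤ D k := fun k => by
    rw [hD]; exact Finset.sum_nonneg fun _ _ => Finset.sum_nonneg fun _ _ => sq_nonneg _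
  refine le_trans ?_ (h.sum_sqrt_le (rpow_mem_lpBall hR hR1 a) (rpow_mem_lpBall hC hC1 b)
    (rpow_mem_lpBall hD0 hD1 c))
  rw [← sum_rotate, ← sum_rotate]
  refine Finset.sum_le_sum fun k _ => ?_
  have hcs : ∑ i, ∑ j, T i j k ^ 2 * (R i ^ a * C j ^ b) ≤
      √(D k) * √(∑ i, ∑ j, (T i j k * (R i ^ a * C j ^ b)) ^ 2) := by
    rw [hD]
    simp only [← Fintype.sum_prod_type']
    refine le_trans (le_of_eq ?_) (Real.sum_mul_le_sqrt_mul_sqrt _ _ _)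
    exact Finset.sum_congr rfl fun t _ => by ring
  have e : ∑ i, ∑ j, T i j k ^ 2 * (R i ^ a * C j ^ b * D k ^ (c - 1 / 2)) =
      D k ^ (c - 1 / 2) * ∑ i, ∑ j, T i j k ^ 2 * (R i ^ a * C j ^ b) := by
    simp only [Finset.mul_sum]
    exact Finset.sum_congr rfl fun i _ => Finset.sum_congr rfl fun j _ => by ring
  rw [e, abs_of_nonneg (Real.rpow_nonneg (hD0 k) c)]
  refine (mul_le_mul_of_nonneg_left hcs (Real.rpow_nonneg (hD0 k) _)).trans ?_
  rcases (hD0 k).eq_or_lt' with h0 | hpos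
  · rw [h0]
    simp only [Real.sqrt_zero, zero_mul, mul_zero]
    exact mul_nonneg (Real.rpow_nonneg le_rfl c) (Real.sqrt_nonneg _)
  · rw [← mul_assoc, Real.sqrt_eq_rpow (D k), ← Real.rpow_add hpos, sub_add_cancel]

/-- The weights `2a`, `2b`, `2c` add up to `1`, and the corresponding geometric mean is `1`: the
exponent of `u` in it is `2a(a + b + c - 1/2) = 0`, and likewise for `v` and `w`. This lets the
three versions of `FormBound.sum_weight_le` be combined. -/
lemma one_le_weighted_mean (ha : 0 ≤ a) (hb : 0 ≤ b) (hc : 0 ≤ c) (habc : a + b + c = 1 / 2)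
    {u v w : ℝ} (hu : 0 < u) (hv : 0 < v) (hw : 0 < w) :
    1 ≤ 2 * a * (v ^ b * w ^ c * u ^ (a - 1 / 2)) + 2 * b * (w ^ c * u ^ a * v ^ (b - 1 / 2)) +
      2 * c * (u ^ a * v ^ b * w ^ (c - 1 / 2)) := by
  refine le_trans (le_of_eq ?_) (Real.geom_mean_le_arith_mean3_weighted (by positivity)
    (by positivity) (by positivity) (by positivity) (by positivity) (by positivity)
    (by linarith))
  rw [← Real.exp_log hu, ← Real.exp_log hv, ← Real.exp_log hw]
  generalize Real.log u = α
  generalize Real.log v = β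
  generalize Real.log w = γ
  simp only [← Real.exp_mul, ← Real.exp_add]
  rw [eq_comm, Real.exp_eq_one_iff]
  have hc' : c = 1 / 2 - a - b := by linarith
  subst hc'
  ring

/-- The Hardy-Littlewood inequality for trilinear forms at the critical exponents. -/
lemma FormBound.hsNorm_le (h : FormBound a b c T N) (ha : 0 ≤ a) (hb : 0 ≤ b) (hc : 0 ≤ c)
    (habc : a + b + c = 1 / 2) : hsNorm T ≤ 784 * N := by
  have main : ∀ {T : ι → κ → μ → ℝ} {N : ℝ}, FormBound a b c T N →
      ∑ i, ∑ j, ∑ k, T i j k ^ 2 = 1 → 1 ≤ 784 * N := by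
    intro T N h h1
    -- After normalization `T ^ 2` is a probability distribution, and `R`, `C`, `D` are its
    -- marginals.
    let R : ι → ℝ := fun i => ∑ j, ∑ k, T i j k ^ 2
    let C : κ → ℝ := fun j => ∑ k, ∑ i, T i j k ^ 2
    let D : μ → ℝ := fun k => ∑ i, ∑ j, T i j k ^ 2
    have hR : ∀ i, 0 ≤ R i := fun i => Finset.sum_nonneg fun _ _ =>
      Finset.sum_nonneg fun _ _ => sq_nonneg _
    have hC : ∀ i, 0 ≤ C i := fun i => Finset.sum_nonneg fun _ _ =>
      Finset.sum_nonneg fun _ _ => sq_nonneg _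
    have hD : ∀ i, 0 ≤ D i := fun i => Finset.sum_nonneg fun _ _ =>
      Finset.sum_nonneg fun _ _ => sq_nonneg _
    have hR1 : ∑ i, R i ≤ 1 := h1.le
    have hC1 : ∑ i, C i ≤ 1 := (sum_rotate (fun i j k => T i j k ^ 2)).trans_le h1.le
    have hD1 : ∑ i, D i ≤ 1 := by
      refine le_of_eq ?_
      simp only [D]
      rw [sum_rotate fun j k i => T i j k ^ 2, sum_rotate fun i j k => T i j k ^ 2, h1]
    have hc3 := h.sum_weight_le hR hR1 hC hC1 (fun k => rfl) hD1
    have hc1 := h.rotate.sum_weight_le hC hC1 hD hD1 (fun k => rfl) hR1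
    have hc2 := h.rotate.rotate.sum_weight_le hD hD1 hR hR1 (fun k => rfl) hC1
    rw [sum_rotate fun i j k => T i j k ^ 2 * (C j ^ b * D k ^ c * R i ^ (a - 1 / 2))] at hc1
    rw [sum_rotate fun j k i => T i j k ^ 2 * (D k ^ c * R i ^ a * C j ^ (b - 1 / 2)),
      sum_rotate fun i j k => T i j k ^ 2 * (D k ^ c * R i ^ a * C j ^ (b - 1 / 2))] at hc2
    have key : ∑ i, ∑ j, ∑ k, T i j k ^ 2 ≤
        2 * a * ∑ i, ∑ j, ∑ k, T i j k ^ 2 * (C j ^ b * D k ^ c * R i ^ (a - 1 / 2)) +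
        2 * b * ∑ i, ∑ j, ∑ k, T i j k ^ 2 * (D k ^ c * R i ^ a * C j ^ (b - 1 / 2)) +
        2 * c * ∑ i, ∑ j, ∑ k, T i j k ^ 2 * (R i ^ a * C j ^ b * D k ^ (c - 1 / 2)) := by
      simp only [Finset.mul_sum, ← Finset.sum_add_distrib]
      refine Finset.sum_le_sum fun i _ => Finset.sum_le_sum fun j _ =>
        Finset.sum_le_sum fun k _ => ?_
      rcases (sq_nonneg (T i j k)).eq_or_lt' with h0 | hpos
      · simp [h0]
      have pR : 0 < R i := hpos.trans_le <|
        (Finset.single_le_sum (f := fun k => T i j k ^ 2) (fun _ _ => sq_nonneg _)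
          (Finset.mem_univ k)).trans
        (Finset.single_le_sum (f := fun j => ∑ k, T i j k ^ 2)
          (fun _ _ => Finset.sum_nonneg fun _ _ => sq_nonneg _) (Finset.mem_univ j))
      have pC : 0 < C j := hpos.trans_le <|
        (Finset.single_le_sum (f := fun i => T i j k ^ 2) (fun _ _ => sq_nonneg _)
          (Finset.mem_univ i)).trans
        (Finset.single_le_sum (f := fun k => ∑ i, T i j k ^ 2)
          (fun _ _ => Finset.sum_nonneg fun _ _ => sq_nonneg _) (Finset.mem_univ k))
      have pD : 0 < D k := hpos.trans_le <|
        (Finset.single_le_sum (f := fun j => T i j k ^ 2) (fun _ _ => sq_nonneg _)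
          (Finset.mem_univ j)).trans
        (Finset.single_le_sum (f := fun i => ∑ j, T i j k ^ 2)
          (fun _ _ => Finset.sum_nonneg fun _ _ => sq_nonneg _) (Finset.mem_univ i))
      have := mul_le_mul_of_nonneg_left (one_le_weighted_mean ha hb hc habc pR pC pD) hpos.le
      linarith
    rw [h1] at key
    have k1 := mul_le_mul_of_nonneg_left hc1 (by positivity : 0 ≤ 2 * a)
    have k2 := mul_le_mul_of_nonneg_left hc2 (by positivity : 0 ≤ 2 * b)
    have k3 := mul_le_mul_of_nonneg_left hc3 (by positivity : 0 ≤ 2 * c)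
    have : 2 * a * (784 * N) + 2 * b * (784 * N) + 2 * c * (784 * N) = 784 * N := by
      have : 2 * a * (784 * N) + 2 * b * (784 * N) + 2 * c * (784 * N) =
        2 * (a + b + c) * (784 * N) := by ring
      rw [this, habc]; ring
    linarith
  have hnn : 0 ≤ hsNorm T := Real.sqrt_nonneg _
  rcases hnn.eq_or_lt' with h0 | hpos
  · rw [h0]; linarith [h.nonneg]
  have h' : FormBound a b c (fun i j k => T i j k / hsNorm T) (N / hsNorm T) := by
    intro x hx y hy z hz
    have e : triForm (fun i j k => T i j k / hsNorm T) x y z = triForm T x y z / hsNorm T := by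
      simp only [triForm, Finset.sum_div]
      exact Finset.sum_congr rfl fun i _ => Finset.sum_congr rfl fun j _ =>
        Finset.sum_congr rfl fun k _ => by ring
    rw [e, abs_div, abs_of_pos hpos]
    exact div_le_div_of_nonneg_right (h x hx y hy z hz) hnn
  have := main h' (by
    simp only [div_pow, ← Finset.sum_div, ← hsNorm_sq]
    exact div_self (by positivity))
  rwa [← mul_div_assoc, le_div_iff₀ hpos, one_mul] at this

/-- The Hardy-Littlewood inequality for the bilinear slices of a trilinear form. -/
lemma FormBound.sum_slice_sq_le [DecidableEq ι] (h : FormBound a b c T N) (hb : 0 ≤ b)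
    (hc : 0 ≤ c) (hbc : b + c = 1 / 2) (i : ι) :
    ∑ j, ∑ k, T i j k ^ 2 ≤ (784 * N) ^ 2 := by
  -- A slice is viewed as a trilinear form with a one-point first index set, whose exponent may be
  -- taken to be `0`, so that the critical condition reads `b + c = 1 / 2`.
  have h' : FormBound 0 b c (fun _ : Unit => T i) N := by
    intro x hx y hy z hz
    have := h _ (single_mem_lpBall a i (abs_le_one_of_mem_lpBall le_rfl hx ())) y hy z hz
    convert this using 2
    simp [triForm, Pi.single_apply]
  have h2 := h'.hsNorm_le le_rfl hb hc (by linarith)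
  have h3 := pow_le_pow_left₀ (Real.sqrt_nonneg _) h2 2
  change hsNorm (fun _ : Unit => T i) ^ 2 ≤ _ at h3
  rw [hsNorm_sq] at h3
  simpa using h3

end HardyLittlewood

/-! ### Upper bounds for the Hilbert-Schmidt norm in each range of exponents. -/

section Upper

open scoped BigOperators

lemma sum_sq_le_of_forall_lpBall_half {μ : Type*} [Fintype μ] {v : μ → ℝ} {N : ℝ}
    (h : ∀ z ∈ (lpBall (1 / 2) : Set (μ → ℝ)), |∑ k, z k * v k| ≤ N) :
    ∑ k, v k ^ 2 ≤ N ^ 2 := by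
  have hN : 0 ≤ N := (abs_nonneg _).trans (h 0 (zero_mem_lpBall _))
  set σ := √(∑ k, v k ^ 2)
  have hσ0 : 0 ≤ σ := Real.sqrt_nonneg _
  have hσ2 : σ ^ 2 = ∑ k, v k ^ 2 := Real.sq_sqrt (Finset.sum_nonneg fun _ _ => sq_nonneg _)
  rw [← hσ2]
  refine pow_le_pow_left₀ hσ0 ?_ 2
  rcases hσ0.eq_or_lt' with h0 | hpos
  · rwa [h0]
  have h1 := h (fun k => v k / σ) (mem_lpBall_half (by
    simp only [div_pow, ← Finset.sum_div, ← hσ2]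
    exact (div_self (by positivity)).le))
  have e : ∑ k, v k / σ * v k = σ := by
    have : ∑ k, v k / σ * v k = (∑ k, v k ^ 2) / σ := by
      rw [Finset.sum_div]
      exact Finset.sum_congr rfl fun k _ => by ring
    rw [this, ← hσ2, sq, mul_div_cancel_right₀ _ hpos.ne']
  rw [e] at h1
  exact (le_abs_self _).trans h1

variable {ι κ μ : Type*} [Fintype ι] [Fintype κ] [Fintype μ] {T : ι → κ → μ → ℝ} {a b c N : ℝ}

lemma FormBound.sum_fiber_sq_le (h : FormBound a b (1 / 2) T N) {x : ι → ℝ}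
    (hx : x ∈ lpBall a) {y : κ → ℝ} (hy : y ∈ lpBall b) :
    ∑ k, (∑ i, ∑ j, T i j k * (x i * y j)) ^ 2 ≤ N ^ 2 :=
  sum_sq_le_of_forall_lpBall_half fun z hz => by
    rw [← triForm_eq]; exact h x hx y hy z hz

lemma FormBound.sum_sq_third_le [DecidableEq ι] [DecidableEq κ] (h : FormBound a b (1 / 2) T N)
    (i : ι) (j : κ) : ∑ k, T i j k ^ 2 ≤ N ^ 2 := by
  have := h.sum_fiber_sq_le (single_mem_lpBall a i (abs_one (α := ℝ)).le)
    (single_mem_lpBall b j (abs_one (α := ℝ)).le)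
  simpa [Pi.single_apply] using this

/-- All sign vectors lie in the `ℓ_∞` ball. Averaging over them removes the cross terms by
orthogonality, so no constant is lost. -/
lemma FormBound.sum_sq_first_third_le [DecidableEq ι] [DecidableEq κ]
    (h : FormBound 0 b (1 / 2) T N) (j : κ) : ∑ i, ∑ k, T i j k ^ 2 ≤ N ^ 2 := by
  have key : 𝔼 ε : ι → Bool, ∑ k, (∑ i, boolSign (ε i) * T i j k) ^ 2 ≤ N ^ 2 := by
    refine Finset.expect_le Finset.univ_nonempty fun ε _ => ?_
    have := h.sum_fiber_sq_le (mem_lpBall_zero fun i => (abs_boolSign (ε i)).le)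
      (single_mem_lpBall b j (abs_one (α := ℝ)).le)
    refine le_trans (le_of_eq ?_) this
    simp [Pi.single_apply, mul_comm]
  rw [Finset.expect_sum_comm] at key
  simp only [expect_sq_sum_boolSign] at key
  rwa [Finset.sum_comm]

/-- The same orthogonality argument is used in two sets of signs, with the third variable handled by
self-duality of `ℓ_2`. -/
lemma FormBound.hsNorm_le_of_zero_zero_half (h : FormBound 0 0 (1 / 2) T N) :
    hsNorm T ≤ N := by
  classical
  refine abs_le_of_sq_le_sq' ?_ h.nonneg |>.2
  rw [hsNorm_sq, ← sum_rotate, ← sum_rotate]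
  have key : 𝔼 ε : ι → Bool, 𝔼 δ : κ → Bool,
      ∑ k, (∑ i, ∑ j, boolSign (ε i) * boolSign (δ j) * T i j k) ^ 2 ≤ N ^ 2 := by
    refine Finset.expect_le Finset.univ_nonempty fun ε _ =>
      Finset.expect_le Finset.univ_nonempty fun δ _ => ?_
    have := h.sum_fiber_sq_le (mem_lpBall_zero fun i => (abs_boolSign (ε i)).le)
      (mem_lpBall_zero fun i => (abs_boolSign (δ i)).le)
    refine le_trans (le_of_eq ?_) this
    exact Finset.sum_congr rfl fun k _ => congrArg (· ^ 2) (Finset.sum_congr rfl fun i _ =>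
      Finset.sum_congr rfl fun j _ => mul_comm _ _)
  simpa only [Finset.expect_sum_comm, expect_sq_double_sum_boolSign] using key

variable {n : ℕ} {T : Fin n → Fin n → Fin n → ℝ}

lemma hsNorm_le_of_sum_slice_sq_le {B : ℝ} (hB : 0 ≤ B)
    (h : ∀ i, ∑ j, ∑ k, T i j k ^ 2 ≤ B ^ 2) : hsNorm T ≤ (n : ℝ) ^ (1 / 2 : ℝ) * B := by
  refine abs_le_of_sq_le_sq' ?_ (by positivity) |>.2
  rw [hsNorm_sq, mul_pow, ← Real.sqrt_eq_rpow, Real.sq_sqrt (by positivity)]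
  refine (Finset.sum_le_sum fun i _ => h i).trans_eq ?_
  simp

variable [NeZero n]

/-- Each of the `n ^ 2` fibres in the third direction has Euclidean norm at most `N`. -/
lemma FormBound.hsNorm_le_of_half (h : FormBound a b (1 / 2) T N) : hsNorm T ≤ n * N := by
  have hN := h.nonneg
  have hn : (0 : ℝ) < n := by exact_mod_cast Nat.pos_of_neZero n
  have := hsNorm_le_of_sum_slice_sq_le (T := T) (B := (n : ℝ) ^ (1 / 2 : ℝ) * N) (by positivity)
    fun i => by
      rw [mul_pow, ← Real.sqrt_eq_rpow, Real.sq_sqrt hn.le]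
      refine (Finset.sum_le_sum fun j _ => h.sum_sq_third_le i j).trans_eq ?_
      simp
  rwa [← mul_assoc, ← Real.rpow_add hn, add_halves, Real.rpow_one] at this

lemma FormBound.hsNorm_le_of_half_le (h : FormBound a b c T N) (ha : 0 ≤ a) (hb : 0 ≤ b)
    (hc : 1 / 2 ≤ c) : hsNorm T ≤ (n : ℝ) ^ (1 / 2 + c) * N := by
  have hn : (0 : ℝ) < n := by exact_mod_cast Nat.pos_of_neZero n
  have := (h.change (c' := 1 / 2) ha hb (by linarith) ha hb (by norm_num)).hsNorm_le_of_half
  rw [sub_self, sub_self, max_self, add_zero, zero_add, max_eq_left (by linarith), ← mul_assoc]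
    at this
  refine this.trans_eq (congrArg (· * N) ?_)
  nth_rw 1 [← Real.rpow_one (n : ℝ)]
  rw [← Real.rpow_add hn]
  ring_nf

lemma FormBound.hsNorm_le_of_le_half (h : FormBound a b c T N) (ha : 0 ≤ a) (hb : 0 ≤ b)
    (hc0 : 0 ≤ c) (hc : c ≤ 1 / 2) : hsNorm T ≤ n * N := by
  have := (h.change (c' := 1 / 2) ha hb hc0 ha hb (by norm_num)).hsNorm_le_of_half
  rw [max_eq_right (sub_nonpos.2 hc)] at this
  simpa using this

/-- Moving to the exponents `(1/2, 0, 0)` costs `n ^ (a - 1/2 + b + c)`, and there is no further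
loss. -/
lemma FormBound.hsNorm_le_of_half_le_first (h : FormBound a b c T N) (ha : 1 / 2 ≤ a)
    (hb : 0 ≤ b) (hc : 0 ≤ c) : hsNorm T ≤ (n : ℝ) ^ (a + b + c - 1 / 2) * N := by
  have := (h.change (a' := 1 / 2) (b' := 0) (c' := 0) (by linarith) hb hc (by norm_num)
    le_rfl le_rfl).rotate.hsNorm_le_of_zero_zero_half
  rw [hsNorm_rotate, max_eq_left (by linarith), max_eq_left (by linarith),
    max_eq_left (by linarith)] at this
  refine this.trans_eq (congrArg (· * N) (congrArg _ ?_))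
  ring

/-- At `(a, 1/2, 0)` each slice with `i` fixed is controlled by orthogonality. The move costs `n ^
(b - 1/2 + c)` and summing the `n` slices costs `n ^ (1/2)`. -/
lemma FormBound.hsNorm_le_of_half_le_second (h : FormBound a b c T N) (ha : 0 ≤ a)
    (hb : 1 / 2 ≤ b) (hc : 0 ≤ c) : hsNorm T ≤ (n : ℝ) ^ (b + c) * N := by
  have hn : (0 : ℝ) < n := by exact_mod_cast Nat.pos_of_neZero n
  have h1 := h.change (a' := a) (b' := 1 / 2) (c' := 0) ha (by linarith) hc ha (by norm_num)
    le_rfl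
  have h2 := hsNorm_le_of_sum_slice_sq_le h1.nonneg fun i => by
    rw [Finset.sum_comm]
    exact h1.rotate.rotate.sum_sq_first_third_le i
  rw [sub_self, max_self, zero_add, max_eq_left (by linarith), max_eq_left (by linarith),
    ← mul_assoc, ← Real.rpow_add hn] at h2
  refine h2.trans_eq (congrArg (· * N) (congrArg _ ?_))
  ring

/-- Lines up the last two exponents as `b` and `1/2 - b`, which is critical for Hardy-Littlewood on
slices, then sums the `n` slices. -/
lemma FormBound.hsNorm_le_of_slices (h : FormBound a b c T N) (ha : 0 ≤ a) (hb0 : 0 ≤ b)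
    (hb : b ≤ 1 / 2) (hc : 0 ≤ c) :
    hsNorm T ≤ 784 * (n : ℝ) ^ max (b + c) (1 / 2) * N := by
  have hn : (0 : ℝ) < n := by exact_mod_cast Nat.pos_of_neZero n
  have h1 := h.change (a' := a) (b' := b) (c' := 1 / 2 - b) ha hb0 hc ha hb0 (by linarith)
  have h2 := hsNorm_le_of_sum_slice_sq_le (mul_nonneg (by norm_num) h1.nonneg)
    (h1.sum_slice_sq_le hb0 (by linarith) (by ring))
  refine h2.trans_eq ?_
  rw [sub_self, sub_self, max_self, zero_add, zero_add]
  have e : max (b + c) (1 / 2) = 1 / 2 + max (c - (1 / 2 - b)) 0 := by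
    rw [← max_add_add_left]
    congr 1 <;> ring
  rw [e, Real.rpow_add hn]
  ring

/-- The target exponents sum to `1/2`: `a` is kept, as much of `b` as fits is kept, and the third
takes what remains. The total cost is then exactly the excess of `a + b + c` over `1/2`, or nothing.
-/
lemma FormBound.hsNorm_le_of_all_le_half (h : FormBound a b c T N) (ha0 : 0 ≤ a)
    (ha : a ≤ 1 / 2) (hb : 0 ≤ b) (hc : 0 ≤ c) :
    hsNorm T ≤ 784 * (n : ℝ) ^ (max (a + b + c) (1 / 2) - 1 / 2) * N := by
  have h1 := (h.change (a' := a) (b' := min b (1 / 2 - a)) (c' := 1 / 2 - a - min b (1 / 2 - a))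
    ha0 hb hc ha0 (le_min hb (by linarith)) (by linarith [min_le_right b (1 / 2 - a)])).hsNorm_le
    ha0 (le_min hb (by linarith)) (by linarith [min_le_right b (1 / 2 - a)]) (by ring)
  rw [← mul_assoc] at h1
  refine h1.trans_eq (congrArg (· * N) (congrArg _ (congrArg _ ?_)))
  rw [sub_self, max_self, zero_add]
  rcases le_total b (1 / 2 - a) with hle | hle
  · rw [min_eq_left hle, sub_self, max_self, zero_add, ← max_sub_sub_right]
    congr 1 <;> ring
  · rw [min_eq_right hle, sub_self, sub_zero, max_eq_left (by linarith), max_eq_left hc,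
      max_eq_left (by linarith)]
    ring

end Upper

/-! ### Deterministic test arrays: the diagonal and a single entry. -/

section Diagonal

variable {n : ℕ} {a b c : ℝ}

/-- The diagonal array. -/
def diagArray (n : ℕ) (i j k : Fin n) : ℝ := if i = j ∧ j = k then 1 else 0

lemma triForm_diagArray (x y z : Fin n → ℝ) :
    triForm (diagArray n) x y z = ∑ i, x i * y i * z i := by
  refine Finset.sum_congr rfl fun i _ => ?_
  rw [Finset.sum_eq_single i, Finset.sum_eq_single i]
  · simp [diagArray]
  · intro k _ hk
    simp [diagArray, hk.symm]
  · simp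
  · intro j _ hj
    exact Finset.sum_eq_zero fun k _ => by simp [diagArray, hj.symm]
  · simp

lemma hsNorm_diagArray (n : ℕ) : hsNorm (diagArray n) = (n : ℝ) ^ (1 / 2 : ℝ) := by
  have h : ∑ i, ∑ j, ∑ k, diagArray n i j k ^ 2 = triForm (diagArray n) 1 1 1 := by
    simp only [triForm, Pi.one_apply, mul_one]
    exact Finset.sum_congr rfl fun i _ => Finset.sum_congr rfl fun j _ =>
      Finset.sum_congr rfl fun k _ => by unfold diagArray; split_ifs <;> norm_num
  rw [hsNorm, h, triForm_diagArray, ← Real.sqrt_eq_rpow]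
  simp

lemma formBound_diagArray_one (ha : 0 ≤ a) (hb : 0 ≤ b) (hc : 0 ≤ c) (habc : a + b + c = 1) :
    FormBound a b c (diagArray n) 1 := by
  rintro x ⟨s, hs, hs1, hx⟩ y ⟨t, ht, ht1, hy⟩ z ⟨u, hu, hu1, hz⟩
  rw [triForm_diagArray]
  refine (Finset.abs_sum_le_sum_abs _ _).trans ?_
  calc ∑ i, |x i * y i * z i| ≤ ∑ i, (a * s i + b * t i + c * u i) := by
        refine Finset.sum_le_sum fun i _ => ?_
        rw [abs_mul, abs_mul]
        refine le_trans ?_ (Real.geom_mean_le_arith_mean3_weighted ha hb hc (hs i) (ht i) (hu i)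
          habc)
        exact mul_le_mul (mul_le_mul (hx i) (hy i) (abs_nonneg _) (Real.rpow_nonneg (hs i) _))
          (hz i) (abs_nonneg _)
          (mul_nonneg (Real.rpow_nonneg (hs i) _) (Real.rpow_nonneg (ht i) _))
    _ ≤ 1 := by
        rw [Finset.sum_add_distrib, Finset.sum_add_distrib, ← Finset.mul_sum, ← Finset.mul_sum,
          ← Finset.mul_sum]
        nlinarith

/-- If `a + b + c < 1`, the first exponent is raised until the sum is `1`, at a Hölder cost. If the
sum exceeds `1`, all exponents are scaled down to sum `1`, which is free because the balls only
grow. -/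
lemma formBound_diagArray [NeZero n] (ha : 0 ≤ a) (hb : 0 ≤ b) (hc : 0 ≤ c) :
    FormBound a b c (diagArray n) ((n : ℝ) ^ max (1 - (a + b + c)) 0) := by
  rcases le_total (a + b + c) 1 with h | h
  · have := (formBound_diagArray_one (n := n) (a := a + (1 - (a + b + c))) (by linarith) hb hc
      (by ring)).change (by linarith) hb hc ha hb hc
    simpa [sub_self] using this
  · have hs : 0 < a + b + c := by linarith
    have hle : ∀ {t : ℝ}, 0 ≤ t → t / (a + b + c) ≤ t := fun ht => div_le_self ht h
    have := (formBound_diagArray_one (n := n) (a := a / (a + b + c)) (b := b / (a + b + c))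
      (c := c / (a + b + c)) (by positivity) (by positivity) (by positivity)
      (by field_simp)).change (by positivity) (by positivity) (by positivity) ha hb hc
    rw [max_eq_right (sub_nonpos.2 (hle ha)), max_eq_right (sub_nonpos.2 (hle hb)),
      max_eq_right (sub_nonpos.2 (hle hc))] at this
    rw [max_eq_right (by linarith)]
    simpa using this

/-- The array with a single nonzero entry. -/
def cornerArray (n : ℕ) [NeZero n] (i j k : Fin n) : ℝ := if i = 0 ∧ j = 0 ∧ k = 0 then 1 else 0

lemma triForm_cornerArray [NeZero n] (x y z : Fin n → ℝ) :
    triForm (cornerArray n) x y z = x 0 * y 0 * z 0 := by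
  unfold triForm
  rw [Finset.sum_eq_single 0, Finset.sum_eq_single 0, Finset.sum_eq_single 0]
  · simp [cornerArray]
  all_goals simp +contextual [cornerArray]

lemma hsNorm_cornerArray (n : ℕ) [NeZero n] : hsNorm (cornerArray n) = 1 := by
  have h : ∑ i, ∑ j, ∑ k, cornerArray n i j k ^ 2 = triForm (cornerArray n) 1 1 1 := by
    simp only [triForm, Pi.one_apply, mul_one]
    exact Finset.sum_congr rfl fun i _ => Finset.sum_congr rfl fun j _ =>
      Finset.sum_congr rfl fun k _ => by unfold cornerArray; split_ifs <;> norm_num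
  rw [hsNorm, h, triForm_cornerArray]
  simp

lemma formBound_cornerArray [NeZero n] (ha : 0 ≤ a) (hb : 0 ≤ b) (hc : 0 ≤ c) :
    FormBound a b c (cornerArray n) 1 := by
  intro x hx y hy z hz
  rw [triForm_cornerArray, abs_mul, abs_mul]
  exact mul_le_one₀ (mul_le_one₀ (abs_le_one_of_mem_lpBall ha hx 0) (abs_nonneg _)
    (abs_le_one_of_mem_lpBall hb hy 0)) (abs_nonneg _) (abs_le_one_of_mem_lpBall hc hz 0)

end Diagonal

/-! ### Random sign arrays on Euclidean spaces. -/

section Random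

open scoped BigOperators

/-- The Euclidean unit ball in dimension `n` contains a set of at most `5 ^ n` points on which
every linear functional attains at least half of its norm. -/
lemma exists_norming_finset (n : ℕ) : ∃ S : Finset (Fin n → ℝ), S.card ≤ 5 ^ n ∧
    (∀ c ∈ S, ∑ i, c i ^ 2 ≤ 1) ∧ ∀ (w : Fin n → ℝ) (M : ℝ),
      (∀ c ∈ S, |∑ i, c i * w i| ≤ M) → ∀ x : Fin n → ℝ, ∑ i, x i ^ 2 ≤ 1 →
        |∑ i, x i * w i| ≤ 2 * M := by
  classical
  -- A maximal `1`-separated set in the ball of radius `2` is a `1`-net there. Halving it gives a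
  -- `1/2`-net of the unit ball, and separation bounds its size by `5 ^ n`.
  let P : Finset (EuclideanSpace ℝ (Fin n)) → Prop := fun s => (∀ c ∈ s, ‖c‖ ≤ 2) ∧
    ∀ c ∈ s, ∀ d ∈ s, c ≠ d → 1 ≤ ‖c - d‖
  have hcard : ∀ s, P s → s.card ≤ 5 ^ n := fun s hs => by
    simpa using Besicovitch.card_le_of_separated s hs.1 hs.2
  obtain ⟨s, hs, hmax⟩ : ∃ s, P s ∧ ∀ t, P t → t.card ≤ s.card := by
    let A : Set ℕ := {k | ∃ s, P s ∧ s.card = k}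
    have hA : BddAbove A := ⟨5 ^ n, by rintro _ ⟨s, hs, rfl⟩; exact hcard s hs⟩
    obtain ⟨s, hs, hk⟩ : sSup A ∈ A := Nat.sSup_mem ⟨0, ∅, by simp [P], rfl⟩ hA
    exact ⟨s, hs, fun t ht => hk ▸ le_csSup hA ⟨t, ht, rfl⟩⟩
  have hnet : ∀ x : EuclideanSpace ℝ (Fin n), ‖x‖ ≤ 2 → ∃ c ∈ s, ‖x - c‖ ≤ 1 := by
    intro x hx
    by_contra! hfar
    have hxs : x ∉ s := fun h => by
      have := hfar x h
      rw [sub_self, norm_zero] at this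
      linarith
    have := hmax (insert x s) ⟨by simpa [hx] using hs.1, by
      intro c hc d hd hcd
      rcases Finset.mem_insert.1 hc with rfl | hc'
      · rcases Finset.mem_insert.1 hd with rfl | hd'
        · exact absurd rfl hcd
        · exact (hfar d hd').le
      · rcases Finset.mem_insert.1 hd with rfl | hd'
        · rw [norm_sub_rev]; exact (hfar c hc').le
        · exact hs.2 c hc' d hd' hcd⟩
    rw [Finset.card_insert_of_notMem hxs] at this
    omega
  refine ⟨s.image fun c i => c i / 2, Finset.card_image_le.trans (hcard s hs), ?_, ?_⟩
  · intro c hc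
    obtain ⟨d, hd, rfl⟩ := Finset.mem_image.1 hc
    have h1 := pow_le_pow_left₀ (norm_nonneg d) (hs.1 d hd) 2
    rw [EuclideanSpace.norm_sq_eq] at h1
    simp only [Real.norm_eq_abs, sq_abs] at h1
    simp only [div_pow, ← Finset.sum_div]
    linarith
  · intro w M hM x hx
    let f : EuclideanSpace ℝ (Fin n) →L[ℝ] ℝ := innerSL ℝ (WithLp.toLp 2 w : EuclideanSpace ℝ (Fin n))
    have hf : ∀ v : EuclideanSpace ℝ (Fin n), f v = ∑ i, v i * w i := fun v => by
      simp [f, PiLp.inner_apply]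
    have hfM : ‖f‖ ≤ 2 * M := by
      have hM0 : 0 ≤ M := by
        obtain ⟨c, hc, -⟩ := hnet 0 (by simp)
        exact (abs_nonneg _).trans (hM _ (Finset.mem_image_of_mem _ hc))
      -- Approximating a unit vector by a net point leaves an error of at most `‖f‖ / 2`, which is
      -- absorbed on the left.
      have h1 : ‖f‖ ≤ M + ‖f‖ / 2 := by
        refine ContinuousLinearMap.opNorm_le_of_unit_norm (𝕜 := ℝ) (by positivity) fun v hv => ?_
        obtain ⟨c, hc, hvc⟩ := hnet ((2 : ℝ) • v) (by rw [norm_smul, hv]; norm_num)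
        have hcM := hM _ (Finset.mem_image_of_mem _ hc)
        have e1 : ∑ i, c i / 2 * w i = f c / 2 := by
          rw [hf, Finset.sum_div]
          exact Finset.sum_congr rfl fun i _ => by ring
        rw [e1] at hcM
        have e2 : f v = f c / 2 + f ((2 : ℝ) • v - c) / 2 := by
          rw [map_sub, map_smul, smul_eq_mul]; ring
        have h3 : |f ((2 : ℝ) • v - c)| ≤ ‖f‖ := by
          rw [← Real.norm_eq_abs]
          exact (f.le_opNorm _).trans (mul_le_of_le_one_right (norm_nonneg _) hvc)
        rw [Real.norm_eq_abs, e2]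
        refine (abs_add_le _ _).trans (add_le_add hcM ?_)
        rw [abs_div, abs_two]
        linarith
      linarith
    have hx1 : ‖(WithLp.toLp 2 x : EuclideanSpace ℝ (Fin n))‖ ≤ 1 := by
      rw [EuclideanSpace.norm_eq]
      simpa using hx
    have := f.le_opNorm (WithLp.toLp 2 x)
    rw [hf, Real.norm_eq_abs] at this
    exact this.trans ((mul_le_of_le_one_right (norm_nonneg _) hx1).trans hfM)

lemma triForm_eq_first {ι κ μ : Type*} [Fintype ι] [Fintype κ] [Fintype μ] (T : ι → κ → μ → ℝ)
    (x : ι → ℝ) (y : κ → ℝ) (z : μ → ℝ) :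
    triForm T x y z = ∑ i, x i * ∑ j, ∑ k, T i j k * (y j * z k) := by
  rw [← triForm_rotate, triForm_eq]

lemma triForm_eq_second {ι κ μ : Type*} [Fintype ι] [Fintype κ] [Fintype μ] (T : ι → κ → μ → ℝ)
    (x : ι → ℝ) (y : κ → ℝ) (z : μ → ℝ) :
    triForm T x y z = ∑ j, y j * ∑ k, ∑ i, T i j k * (z k * x i) := by
  rw [← triForm_rotate, triForm_eq_first]

/-- There is an array of signs whose trilinear form on Euclidean spaces has norm of the order
`√n`. -/
lemma exists_sign_array (n : ℕ) [NeZero n] : ∃ T : Fin n → Fin n → Fin n → ℝ,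
    (∀ i j k, |T i j k| = 1) ∧
      FormBound (1 / 2) (1 / 2) (1 / 2) T (56 * (n : ℝ) ^ (1 / 2 : ℝ)) := by
  classical
  obtain ⟨S, hScard, hS, hSnorm⟩ := exists_norming_finset n
  have hn1 : (1 : ℝ) ≤ n := by exact_mod_cast Nat.pos_of_neZero n
  set ν : ℝ := √n
  have hν : 1 ≤ ν := Real.one_le_sqrt.2 hn1
  have hν2 : ν ^ 2 = n := Real.sq_sqrt (by linarith)
  let I := Fin n × Fin n × Fin n
  let X := (Fin n → ℝ) × (Fin n → ℝ) × (Fin n → ℝ)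
  let A : (I → Bool) → Fin n → Fin n → Fin n → ℝ := fun ε i j k => boolSign (ε (i, j, k))
  let G : (I → Bool) → X → ℝ := fun ε t => triForm (A ε) t.1 t.2.1 t.2.2
  have hG : ∀ (c : ℝ) (ε : I → Bool) (t : X), c * G ε t =
      ∑ s : I, boolSign (ε s) * (c * (t.1 s.1 * t.2.1 s.2.1 * t.2.2 s.2.2)) := fun c ε t => by
    simp only [G, triForm, A, I, Fintype.sum_prod_type, Finset.mul_sum]
    exact Finset.sum_congr rfl fun i _ => Finset.sum_congr rfl fun j _ =>
      Finset.sum_congr rfl fun k _ => by ring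
  have hexp : ∀ c : ℝ, c ^ 2 = n → ∀ t ∈ S ×ˢ S ×ˢ S,
      𝔼 ε : I → Bool, Real.exp (c * G ε t) ≤ Real.exp (n / 2) := by
    intro c hc t ht
    simp only [Finset.mem_product] at ht
    simp only [hG]
    refine (expect_exp_sum_boolSign_le _).trans (Real.exp_le_exp.2 ?_)
    have e : ∑ s : I, (c * (t.1 s.1 * t.2.1 s.2.1 * t.2.2 s.2.2)) ^ 2 =
        n * ((∑ i, t.1 i ^ 2) * ((∑ j, t.2.1 j ^ 2) * ∑ k, t.2.2 k ^ 2)) := by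
      simp only [I, Fintype.sum_prod_type, ← hc]
      simp only [Finset.sum_mul, Finset.mul_sum]
      rw [← sum_rotate, ← sum_rotate]
      refine Finset.sum_congr rfl fun k _ => ?_
      rw [Finset.sum_comm]
      exact Finset.sum_congr rfl fun j _ => Finset.sum_congr rfl fun i _ => by ring
    rw [e]
    have nn : ∀ x : Fin n → ℝ, 0 ≤ ∑ i, x i ^ 2 :=
      fun x => Finset.sum_nonneg fun _ _ => sq_nonneg _
    have : (∑ i, t.1 i ^ 2) * ((∑ j, t.2.1 j ^ 2) * ∑ k, t.2.2 k ^ 2) ≤ 1 :=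
      mul_le_one₀ (hS _ ht.1) (mul_nonneg (nn _) (nn _))
        (mul_le_one₀ (hS _ ht.2.1) (nn _) (hS _ ht.2.2))
    have := mul_le_mul_of_nonneg_left this (by linarith : (0 : ℝ) ≤ n)
    linarith
  have hsum : 𝔼 ε : I → Bool, ∑ t ∈ S ×ˢ S ×ˢ S,
      (Real.exp (ν * G ε t) + Real.exp (-ν * G ε t)) ≤ 125 ^ n * (2 * Real.exp (n / 2)) := by
    rw [Finset.expect_sum_comm]
    calc _ ≤ ∑ t ∈ S ×ˢ S ×ˢ S, 2 * Real.exp (n / 2) := by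
          refine Finset.sum_le_sum fun t ht => ?_
          rw [Finset.expect_add_distrib, two_mul]
          exact add_le_add (hexp ν hν2 t ht) (hexp (-ν) (by rw [neg_sq, hν2]) t ht)
      _ ≤ _ := by
          rw [Finset.sum_const, nsmul_eq_mul]
          refine mul_le_mul_of_nonneg_right ?_ (by positivity)
          have h1 : (S ×ˢ S ×ˢ S).card ≤ 125 ^ n := by
            rw [Finset.card_product, Finset.card_product]
            calc _ ≤ 5 ^ n * (5 ^ n * 5 ^ n) :=
                  Nat.mul_le_mul hScard (Nat.mul_le_mul hScard hScard)
              _ = 125 ^ n := by rw [← mul_pow, ← mul_pow]; norm_num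
          exact_mod_cast h1
  -- A single outcome not above the average controls all at most `125 ^ n` triples of net points at
  -- once. With the exponential parameter `ν = √n` the bound is `exp (7n)`, so each value is at most
  -- `7√n`.
  obtain ⟨ε, -, hε⟩ := Finset.exists_le_of_expect_le Finset.univ_nonempty hsum
  refine ⟨A ε, fun i j k => abs_boolSign _, ?_⟩
  have hpt : ∀ t ∈ S ×ˢ S ×ˢ S, |G ε t| ≤ 7 * ν := by
    intro t ht
    have h1 : Real.exp (ν * |G ε t|) ≤ 125 ^ n * (2 * Real.exp (n / 2)) := by
      refine le_trans ?_ ((Finset.single_le_sum (f := fun t =>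
        Real.exp (ν * G ε t) + Real.exp (-ν * G ε t)) (fun _ _ => by positivity) ht).trans hε)
      rcases abs_cases (G ε t) with ⟨e, -⟩ | ⟨e, -⟩ <;> rw [e]
      · exact le_add_of_nonneg_right (Real.exp_pos _).le
      · rw [mul_neg, ← neg_mul]
        exact le_add_of_nonneg_left (Real.exp_pos _).le
    have h2 : (125 : ℝ) ^ n * (2 * Real.exp (n / 2)) ≤ Real.exp (7 * n) := by
      have e5 : (125 : ℝ) ≤ Real.exp 5 := by
        have : Real.exp 5 = Real.exp 1 ^ 5 := by rw [← Real.exp_nat_mul]; norm_num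
        rw [this]
        calc (125 : ℝ) ≤ 2.7 ^ 5 := by norm_num
          _ ≤ _ := pow_le_pow_left₀ (by norm_num) (by linarith [Real.exp_one_gt_d9]) 5
      have e1 : (2 : ℝ) ≤ Real.exp n := by linarith [Real.add_one_le_exp (n : ℝ)]
      calc (125 : ℝ) ^ n * (2 * Real.exp (n / 2))
          ≤ Real.exp 5 ^ n * (Real.exp n * Real.exp (n / 2)) := by gcongr
        _ = Real.exp (n * 5 + (n + n / 2)) := by
          rw [← Real.exp_nat_mul, ← Real.exp_add, ← Real.exp_add]
        _ ≤ _ := Real.exp_le_exp.2 (by linarith)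
    have h3 := Real.exp_le_exp.1 (h1.trans h2)
    refine le_of_mul_le_mul_left ?_ (by linarith : 0 < ν)
    rw [← hν2] at h3
    linarith
  intro x hx y hy z hz
  have hx := sum_sq_le_one_of_mem_lpBall_half hx
  have hy := sum_sq_le_one_of_mem_lpBall_half hy
  have hz := sum_sq_le_one_of_mem_lpBall_half hz
  rw [← Real.sqrt_eq_rpow]
  -- Net points are replaced by arbitrary unit vectors one variable at a time. Each replacement
  -- doubles the bound, which gives `8 * 7 = 56`.
  have s1 : ∀ y ∈ S, ∀ z ∈ S, |triForm (A ε) x y z| ≤ 2 * (7 * ν) := fun y hy z hz => by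
    rw [triForm_eq_first]
    refine hSnorm _ _ (fun c hc => ?_) x hx
    rw [← triForm_eq_first]
    exact hpt (c, y, z) (by simp [hc, hy, hz])
  have s2 : ∀ z ∈ S, |triForm (A ε) x y z| ≤ 2 * (2 * (7 * ν)) := fun z hz => by
    rw [triForm_eq_second]
    refine hSnorm _ _ (fun c hc => ?_) y hy
    rw [← triForm_eq_second]
    exact s1 c hc z hz
  have s3 : |triForm (A ε) x y z| ≤ 2 * (2 * (2 * (7 * ν))) := by
    rw [triForm_eq]
    refine hSnorm _ _ (fun c hc => ?_) z hz
    rw [← triForm_eq]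
    exact s2 c hc
  linarith

lemma hsNorm_of_abs_eq_one {n : ℕ} {T : Fin n → Fin n → Fin n → ℝ}
    (hT : ∀ i j k, |T i j k| = 1) : hsNorm T = (n : ℝ) ^ (3 / 2 : ℝ) := by
  have h : ∀ i j k, T i j k ^ 2 = 1 := fun i j k => by rw [← sq_abs, hT]; norm_num
  have e : ∑ i, ∑ j, ∑ k, T i j k ^ 2 = (n : ℝ) ^ (3 : ℝ) := by
    simp only [h]
    simp
    ring
  rw [hsNorm, e, Real.sqrt_eq_rpow, ← Real.rpow_mul (by positivity)]
  norm_num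

end Random

/-! ### Complex interpolation by the three lines theorem. -/

section Interpolation

variable {ι κ μ : Type*} {c : ℝ}

/-- The analytic family of vectors through `x` used in the interpolation argument. -/
noncomputable def analyticVec (c : ℝ) (s x : ι → ℝ) (w : ℂ) (i : ι) : ℂ :=
  ((x i / s i ^ c : ℝ) : ℂ) * Complex.exp (w * (Real.log (s i) : ℝ))

lemma norm_analyticVec_le {s x : ι → ℝ} (hs : ∀ i, 0 ≤ s i) (hx : ∀ i, |x i| ≤ s i ^ c)
    (hc : c ≠ 0) (w : ℂ) (i : ι) : ‖analyticVec c s x w i‖ ≤ s i ^ w.re := by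
  rw [analyticVec, norm_mul, Complex.norm_real, Complex.norm_exp, Real.norm_eq_abs, abs_div]
  rcases (hs i).eq_or_lt' with h0 | hpos
  -- Where the weight vanishes, division by `0 ^ c = 0` gives the value `0`; `c ≠ 0` is essential
  -- here.
  · rw [h0, Real.zero_rpow hc, abs_zero, div_zero, zero_mul]
    exact Real.rpow_nonneg le_rfl _
  · rw [Complex.re_mul_ofReal, Real.rpow_def_of_pos hpos w.re, mul_comm w.re]
    refine mul_le_of_le_one_left (Real.exp_pos _).le ?_
    rw [abs_of_pos (Real.rpow_pos_of_pos hpos c)]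
    exact div_le_one_of_le₀ (hx i) (Real.rpow_nonneg hpos.le c)

lemma analyticVec_self {s x : ι → ℝ} (hs : ∀ i, 0 ≤ s i) (hx : ∀ i, |x i| ≤ s i ^ c)
    (hc : c ≠ 0) (i : ι) : analyticVec c s x c i = x i := by
  rw [analyticVec, ← Complex.ofReal_mul, ← Complex.ofReal_exp, ← Complex.ofReal_mul]
  congr 1
  rcases (hs i).eq_or_lt' with h0 | hpos
  · have := hx i
    rw [h0, Real.zero_rpow hc] at this
    rw [abs_nonpos_iff.1 this]
    simp
  · rw [mul_comm c, ← Real.rpow_def_of_pos hpos, div_mul_cancel₀]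
    exact (Real.rpow_pos_of_pos hpos c).ne'

variable [Fintype ι] [Fintype κ] [Fintype μ] {T : ι → κ → μ → ℝ} {N : ℝ}

/-- Splitting the three vectors into real and imaginary parts writes each of the two parts of the
sum as a combination of four real forms, hence the factor `8`. -/
lemma FormBound.norm_complex_le (h : FormBound c c c T N) {s : ι → ℝ} {t : κ → ℝ} {u : μ → ℝ}
    (hs : ∀ i, 0 ≤ s i) (ht : ∀ i, 0 ≤ t i) (hu : ∀ i, 0 ≤ u i)
    (hs1 : ∑ i, s i ≤ 1) (ht1 : ∑ i, t i ≤ 1) (hu1 : ∑ i, u i ≤ 1)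
    {x : ι → ℂ} {y : κ → ℂ} {z : μ → ℂ} (hx : ∀ i, ‖x i‖ ≤ s i ^ c) (hy : ∀ i, ‖y i‖ ≤ t i ^ c)
    (hz : ∀ i, ‖z i‖ ≤ u i ^ c) :
    ‖∑ i, ∑ j, ∑ k, (T i j k : ℂ) * x i * y j * z k‖ ≤ 8 * N := by
  have hxr : (fun i => (x i).re) ∈ lpBall c :=
    ⟨s, hs, hs1, fun i => (Complex.abs_re_le_norm _).trans (hx i)⟩
  have hxi : (fun i => (x i).im) ∈ lpBall c :=
    ⟨s, hs, hs1, fun i => (Complex.abs_im_le_norm _).trans (hx i)⟩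
  have hyr : (fun i => (y i).re) ∈ lpBall c :=
    ⟨t, ht, ht1, fun i => (Complex.abs_re_le_norm _).trans (hy i)⟩
  have hyi : (fun i => (y i).im) ∈ lpBall c :=
    ⟨t, ht, ht1, fun i => (Complex.abs_im_le_norm _).trans (hy i)⟩
  have hzr : (fun i => (z i).re) ∈ lpBall c :=
    ⟨u, hu, hu1, fun i => (Complex.abs_re_le_norm _).trans (hz i)⟩
  have hzi : (fun i => (z i).im) ∈ lpBall c :=
    ⟨u, hu, hu1, fun i => (Complex.abs_im_le_norm _).trans (hz i)⟩
  set W := ∑ i, ∑ j, ∑ k, (T i j k : ℂ) * x i * y j * z k with hW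
  have hre : W.re = triForm T (fun i => (x i).re) (fun i => (y i).re) (fun i => (z i).re) -
      triForm T (fun i => (x i).re) (fun i => (y i).im) (fun i => (z i).im) -
      triForm T (fun i => (x i).im) (fun i => (y i).re) (fun i => (z i).im) -
      triForm T (fun i => (x i).im) (fun i => (y i).im) (fun i => (z i).re) := by
    simp only [hW, Complex.re_sum, triForm, ← Finset.sum_sub_distrib]
    refine Finset.sum_congr rfl fun i _ => Finset.sum_congr rfl fun j _ =>
      Finset.sum_congr rfl fun k _ => ?_
    simp only [Complex.mul_re, Complex.mul_im, Complex.ofReal_re, Complex.ofReal_im]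
    ring
  have him : W.im = triForm T (fun i => (x i).im) (fun i => (y i).re) (fun i => (z i).re) +
      triForm T (fun i => (x i).re) (fun i => (y i).im) (fun i => (z i).re) +
      triForm T (fun i => (x i).re) (fun i => (y i).re) (fun i => (z i).im) -
      triForm T (fun i => (x i).im) (fun i => (y i).im) (fun i => (z i).im) := by
    simp only [hW, Complex.im_sum, triForm, ← Finset.sum_sub_distrib, ← Finset.sum_add_distrib]
    refine Finset.sum_congr rfl fun i _ => Finset.sum_congr rfl fun j _ =>
      Finset.sum_congr rfl fun k _ => ?_
    simp only [Complex.mul_re, Complex.mul_im, Complex.ofReal_re, Complex.ofReal_im]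
    ring
  refine (Complex.norm_le_abs_re_add_abs_im W).trans ?_
  have h1 := abs_le.1 (h _ hxr _ hyr _ hzr)
  have h2 := abs_le.1 (h _ hxr _ hyi _ hzi)
  have h3 := abs_le.1 (h _ hxi _ hyr _ hzi)
  have h4 := abs_le.1 (h _ hxi _ hyi _ hzr)
  have h5 := abs_le.1 (h _ hxi _ hyr _ hzr)
  have h6 := abs_le.1 (h _ hxr _ hyi _ hzr)
  have h7 := abs_le.1 (h _ hxr _ hyr _ hzi)
  have h8 := abs_le.1 (h _ hxi _ hyi _ hzi)
  have hr : |W.re| ≤ 4 * N := by rw [hre, abs_le]; constructor <;> linarith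
  have hi : |W.im| ≤ 4 * N := by rw [him, abs_le]; constructor <;> linarith
  linarith

/-- Interpolation of trilinear forms between `ℓ_2` and `ℓ_1`. -/
lemma FormBound.interpolate (h : FormBound (1 / 2) (1 / 2) (1 / 2) T N)
    (hT : ∀ i j k, |T i j k| ≤ 1) (hc : 1 / 2 ≤ c) (hc1 : c ≤ 1) :
    FormBound c c c T ((8 * N) ^ (2 - 2 * c)) := by
  rintro x ⟨s, hs, hs1, hx⟩ y ⟨t, ht, ht1, hy⟩ z ⟨u, hu, hu1, hz⟩
  have hc0 : c ≠ 0 := by linarith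
  -- On `Re w = 1/2` the vectors are in the Euclidean balls and `F` is at most `8 * N`. On `Re w =
  -- 1` they are in the `ℓ_1` balls and the entry bound gives `1`. At `w = c` the function is the
  -- given form, and the line `Re w = 1/2` enters with weight `(1 - c) / (1 - 1/2) = 2 - 2c`.
  let F : ℂ → ℂ := fun w => ∑ i, ∑ j, ∑ k, (T i j k : ℂ) * analyticVec c s x w i *
    analyticVec c t y w j * analyticVec c u z w k
  have hF : Differentiable ℂ F := by
    unfold F analyticVec
    fun_prop
  have hle : ∀ w : ℂ, ‖F w‖ ≤ ∑ i, ∑ j, ∑ k, s i ^ w.re * t j ^ w.re * u k ^ w.re := by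
    intro w
    refine norm_sum_le_of_le _ fun i _ => norm_sum_le_of_le _ fun j _ =>
      norm_sum_le_of_le _ fun k _ => ?_
    rw [norm_mul, norm_mul, norm_mul, Complex.norm_real, Real.norm_eq_abs]
    have n1 := norm_analyticVec_le hs hx hc0 w i
    have n2 := norm_analyticVec_le ht hy hc0 w j
    have n3 := norm_analyticVec_le hu hz hc0 w k
    have p1 := Real.rpow_nonneg (hs i) w.re
    have p2 := Real.rpow_nonneg (ht j) w.re
    refine mul_le_mul (mul_le_mul ?_ n2 (norm_nonneg _) p1) n3 (norm_nonneg _) (mul_nonneg p1 p2)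
    exact (mul_le_of_le_one_left (norm_nonneg _) (hT i j k)).trans n1
  have hbdd : BddAbove (norm ∘ F '' Complex.HadamardThreeLines.verticalClosedStrip (1 / 2) 1) := by
    refine ⟨∑ _i : ι, ∑ _j : κ, ∑ _k : μ, 1, ?_⟩
    rintro _ ⟨w, hw, rfl⟩
    have hw0 : 0 ≤ w.re := le_trans (by norm_num) hw.1
    refine (hle w).trans (Finset.sum_le_sum fun i _ => Finset.sum_le_sum fun j _ =>
      Finset.sum_le_sum fun k _ => ?_)
    exact mul_le_one₀ (mul_le_one₀
      (Real.rpow_le_one (hs i) (le_one_of_sum_le_one hs hs1 i) hw0) (Real.rpow_nonneg (ht j) _)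
      (Real.rpow_le_one (ht j) (le_one_of_sum_le_one ht ht1 j) hw0)) (Real.rpow_nonneg (hu k) _)
      (Real.rpow_le_one (hu k) (le_one_of_sum_le_one hu hu1 k) hw0)
  have key := Complex.HadamardThreeLines.norm_le_interp_of_mem_verticalClosedStrip'
    (f := F) (z := (c : ℂ)) (a := 8 * N) (b := 1) (l := 1 / 2) (u := 1) (by norm_num)
    (by simpa [Complex.HadamardThreeLines.verticalClosedStrip] using ⟨by linarith, hc1⟩)
    hF.diffContOnCl hbdd
    (fun w hw => by
      have hw : w.re = 1 / 2 := hw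
      refine h.norm_complex_le hs ht hu hs1 ht1 hu1 (fun i => ?_) (fun i => ?_) (fun i => ?_)
      · rw [← hw]; exact norm_analyticVec_le hs hx hc0 w i
      · rw [← hw]; exact norm_analyticVec_le ht hy hc0 w i
      · rw [← hw]; exact norm_analyticVec_le hu hz hc0 w i)
    (fun w hw => by
      have hw : w.re = 1 := hw
      refine (hle w).trans ?_
      simp only [hw, Real.rpow_one, ← Finset.mul_sum, ← Finset.sum_mul]
      exact mul_le_one₀ (mul_le_one₀ hs1 (Finset.sum_nonneg fun i _ => ht i) ht1)
        (Finset.sum_nonneg fun i _ => hu i) hu1)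
  have hFc : F c = (triForm T x y z : ℝ) := by
    simp only [F, triForm, analyticVec_self hs hx hc0, analyticVec_self ht hy hc0,
      analyticVec_self hu hz hc0]
    push_cast
    rfl
  rw [hFc, Complex.norm_real, Real.norm_eq_abs, Real.one_rpow, mul_one] at key
  convert key using 2
  simp
  ring

end Interpolation

/-! ### Reciprocal exponents. -/

section Exponents

lemma recip_nonneg (p : ℝ≥0∞) : 0 ≤ recip p := ENNReal.toReal_nonneg

lemma recip_le_recip {p q : ℝ≥0∞} [hp : Fact (1 ≤ p)] (h : p ≤ q) : recip q ≤ recip p := by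
  refine ENNReal.toReal_mono ?_ (ENNReal.inv_le_inv.2 h)
  exact ENNReal.inv_ne_top.2 (zero_lt_one.trans_le hp.out).ne'

lemma recip_two : recip 2 = 1 / 2 := by simp [recip]

lemma recip_le_one (p : ℝ≥0∞) [hp : Fact (1 ≤ p)] : recip p ≤ 1 := by
  have := recip_le_recip (hp := ⟨le_rfl⟩) hp.out
  simpa [recip] using this

lemma recip_le_half {p : ℝ≥0∞} (h : 2 ≤ p) : recip p ≤ 1 / 2 := by
  have : Fact ((1 : ℝ≥0∞) ≤ 2) := ⟨one_le_two⟩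
  exact recip_two ▸ recip_le_recip h

lemma half_le_recip {p : ℝ≥0∞} [Fact (1 ≤ p)] (h : p ≤ 2) : 1 / 2 ≤ recip p :=
  recip_two ▸ recip_le_recip h

end Exponents

/-! ### Lower bounds for the norm of the identity. -/

section LowerBounds

variable (p q r : ℝ≥0∞) [Fact (1 ≤ p)] [Fact (1 ≤ q)] [Fact (1 ≤ r)] (n : ℕ) [NeZero n]

/-- The lower bound for the identity that comes from an array of random signs. -/
lemma rpow_random_le_norm_idOp :
    (1 / 448) * (n : ℝ) ^ (1 - (max (1 / 2 - recip p) 0 + max (1 / 2 - recip q) 0 +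
      max (1 / 2 - recip r) 0)) ≤ ‖idOp p q r n‖ := by
  have hn : (0 : ℝ) < n := by exact_mod_cast Nat.pos_of_neZero n
  obtain ⟨T, hT, h⟩ := exists_sign_array n
  refine le_norm_idOp p q r (h.change (by norm_num) (by norm_num) (by norm_num)
    (recip_nonneg p) (recip_nonneg q) (recip_nonneg r)) (by positivity) ?_
  rw [hsNorm_of_abs_eq_one hT]
  set w := max (1 / 2 - recip p) 0 + max (1 / 2 - recip q) 0 + max (1 / 2 - recip r) 0
  have e : (n : ℝ) ^ (3 / 2 : ℝ) =
      (n : ℝ) ^ (1 - w) * ((n : ℝ) ^ w * (n : ℝ) ^ (1 / 2 : ℝ)) := by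
    rw [← Real.rpow_add hn, ← Real.rpow_add hn]
    ring_nf
  rw [e]
  have : 0 < (n : ℝ) ^ (1 - w) * ((n : ℝ) ^ w * (n : ℝ) ^ (1 / 2 : ℝ)) := by positivity
  linarith

/-- The lower bound for the identity when all exponents are at most `2`. -/
lemma rpow_interpolated_le_norm_idOp (hpq : p ≤ q) (hqr : q ≤ r) (hr : r ≤ 2) :
    (1 / 448) * (n : ℝ) ^ (1 / 2 + recip r) ≤ ‖idOp p q r n‖ := by
  have hn : (0 : ℝ) < n := by exact_mod_cast Nat.pos_of_neZero n
  obtain ⟨T, hT, h⟩ := exists_sign_array n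
  set c := recip r
  have hc : 1 / 2 ≤ c := half_le_recip hr
  have hc1 : c ≤ 1 := recip_le_one r
  have hq : c ≤ recip q := recip_le_recip hqr
  have hp : c ≤ recip p := hq.trans (recip_le_recip hpq)
  have h1 := h.interpolate (fun i j k => (hT i j k).le) hc hc1
  have h2 : FormBound (recip p) (recip q) c T ((8 * (56 * (n : ℝ) ^ (1 / 2 : ℝ))) ^ (2 - 2 * c)) :=
    fun x hx y hy z hz => h1 x (lpBall_anti (by linarith) hp hx) y
      (lpBall_anti (by linarith) hq hy) z hz
  refine le_norm_idOp p q r h2 (by positivity) ?_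
  rw [hsNorm_of_abs_eq_one hT]
  have e1 : (8 * (56 * (n : ℝ) ^ (1 / 2 : ℝ))) ^ (2 - 2 * c) =
      (448 : ℝ) ^ (2 - 2 * c) * (n : ℝ) ^ (1 - c) := by
    rw [← mul_assoc, Real.mul_rpow (by norm_num) (by positivity), ← Real.rpow_mul hn.le]
    have e : 1 / 2 * (2 - 2 * c) = 1 - c := by ring
    rw [e]
    norm_num
  -- Here `2 - 2c ≤ 1`, so the constant `448 = 8 * 56` bounds its power for every `c`.
  have e2 : (448 : ℝ) ^ (2 - 2 * c) ≤ 448 := by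
    nth_rw 2 [← Real.rpow_one (448 : ℝ)]
    exact Real.rpow_le_rpow_of_exponent_le (by norm_num) (by linarith)
  have e3 : (n : ℝ) ^ (3 / 2 : ℝ) = (n : ℝ) ^ (1 / 2 + c) * (n : ℝ) ^ (1 - c) := by
    rw [← Real.rpow_add hn]
    ring_nf
  rw [e1, e3]
  have : 0 < (n : ℝ) ^ (1 / 2 + c) * (n : ℝ) ^ (1 - c) := by positivity
  nlinarith

/-- The lower bound for the identity that comes from the diagonal array. -/
lemma rpow_diag_le_norm_idOp :
    (n : ℝ) ^ (1 / 2 - max (1 - (recip p + recip q + recip r)) 0) ≤ ‖idOp p q r n‖ := by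
  have hn : (0 : ℝ) < n := by exact_mod_cast Nat.pos_of_neZero n
  refine le_norm_idOp p q r (formBound_diagArray (recip_nonneg p) (recip_nonneg q)
    (recip_nonneg r)) (by positivity) ?_
  rw [hsNorm_diagArray, ← Real.rpow_add hn, sub_add_cancel]

lemma one_le_norm_idOp : 1 ≤ ‖idOp p q r n‖ :=
  le_norm_idOp p q r (formBound_cornerArray (recip_nonneg p) (recip_nonneg q)
    (recip_nonneg r)) one_pos (by rw [hsNorm_cornerArray, mul_one])

end LowerBounds

/-! ### Assembly of the cases. -/

theorem theoremC :
    ∃ K : ℝ, 0 < K ∧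
    ∀ (p q r : ℝ≥0∞) [Fact (1 ≤ p)] [Fact (1 ≤ q)] [Fact (1 ≤ r)], p ≤ q → q ≤ r →
    ∃ c C : ℝ, 0 < c ∧ 0 < C ∧ ∀ n : ℕ, 1 ≤ n →
      (r ≤ 2 →
        c * (n : ℝ) ^ (1 / 2 + recip r) ≤ ‖idOp p q r n‖ ∧
        ‖idOp p q r n‖ ≤ C * (n : ℝ) ^ (1 / 2 + recip r)) ∧
      (p ≤ 2 → 2 ≤ q → 1 ≤ recip p + recip q + recip r →
        c * (n : ℝ) ^ max (recip q + recip r) (1 / 2) ≤ ‖idOp p q r n‖ ∧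
        ‖idOp p q r n‖ ≤ C * (n : ℝ) ^ max (recip q + recip r) (1 / 2)) ∧
      (p ≤ 2 → 2 ≤ q → recip p + recip q + recip r ≤ 1 →
        c * (n : ℝ) ^ (recip p + recip q + recip r - 1 / 2) ≤ ‖idOp p q r n‖ ∧
        ‖idOp p q r n‖ ≤ C * (n : ℝ) ^ (recip p + recip q + recip r - 1 / 2)) ∧
      (2 ≤ p →
        c * (n : ℝ) ^ (max (recip p + recip q + recip r) (1 / 2) - 1 / 2) ≤ ‖idOp p q r n‖ ∧
        ‖idOp p q r n‖ ≤
          C * (n : ℝ) ^ (max (recip p + recip q + recip r) (1 / 2) - 1 / 2)) ∧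
      (q ≤ 2 → 2 ≤ r →
        c * (n : ℝ) ^ (1 / 2 + recip r) ≤ ‖idOp p q r n‖ ∧
        ‖idOp p q r n‖ ≤ K * (n : ℝ) ^ min (recip q + recip r) 1) := by
  -- The constant `448 = 8 * 56` comes from interpolated random signs and `784 = 28 ^ 2` from the
  -- chaos Khinchin inequality. The upper bound for `q ≤ 2 ≤ r` needs only orthogonality and fibre
  -- bounds, so its universal constant is `1`.
  refine ⟨1, one_pos, fun p q r _ _ _ hpq hqr => ⟨1 / 448, 784, by norm_num, by norm_num,
    fun n hn1 => ?_⟩⟩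
  have : NeZero n := ⟨by omega⟩
  have hn : (0 : ℝ) < n := by exact_mod_cast hn1
  have ha0 := recip_nonneg p
  have hb0 := recip_nonneg q
  have hc0 := recip_nonneg r
  have hab := recip_le_recip hpq
  have hbc := recip_le_recip hqr
  have weaken : ∀ {s t : ℝ}, 0 ≤ t → s ≤ t → s ≤ 784 * t := fun h0 h => by linarith
  have weaken' : ∀ {t : ℝ}, 0 < t → t ≤ ‖idOp p q r n‖ → 1 / 448 * t ≤ ‖idOp p q r n‖ :=
    fun h0 h => by linarith
  have random := rpow_random_le_norm_idOp p q r n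
  have diag := rpow_diag_le_norm_idOp p q r n
  have corner := one_le_norm_idOp p q r n
  refine ⟨fun hr => ⟨rpow_interpolated_le_norm_idOp p q r n hpq hqr hr, ?_⟩,
    fun hp hq hs => ⟨?_, ?_⟩, fun hp hq hs => ⟨?_, ?_⟩, fun hp => ⟨?_, ?_⟩,
    fun hq hr => ⟨?_, ?_⟩⟩
  · exact weaken (by positivity) (norm_idOp_le p q r (by positivity) fun T N h =>
      h.hsNorm_le_of_half_le ha0 hb0 (half_le_recip hr))
  · have ha := half_le_recip hp
    have hb := recip_le_half hq
    rcases le_total (1 / 2) (recip q + recip r) with h | h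
    · rw [max_eq_left h]
      rw [max_eq_right (by linarith), max_eq_left (by linarith), max_eq_left (by linarith)]
        at random
      convert random using 3
      ring
    · rw [max_eq_right h]
      rw [max_eq_right (by linarith), sub_zero] at diag
      exact weaken' (by positivity) diag
  · exact norm_idOp_le p q r (by positivity) fun T N h =>
      h.hsNorm_le_of_slices ha0 hb0 (recip_le_half hq) hc0
  · rw [max_eq_left (by linarith)] at diag
    refine weaken' (by positivity) (le_trans (le_of_eq ?_) diag)
    ring_nf
  · exact weaken (by positivity) (norm_idOp_le p q r (by positivity) fun T N h =>
      h.hsNorm_le_of_half_le_first (half_le_recip hp) hb0 hc0)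
  · have ha := recip_le_half hp
    rcases le_total (1 / 2) (recip p + recip q + recip r) with h | h
    · rw [max_eq_left h]
      rw [max_eq_left (by linarith), max_eq_left (by linarith), max_eq_left (by linarith)]
        at random
      convert random using 3
      ring
    · rw [max_eq_right h, sub_self, Real.rpow_zero]
      exact weaken' one_pos corner
  · exact norm_idOp_le p q r (by positivity) fun T N h =>
      h.hsNorm_le_of_all_le_half ha0 (recip_le_half hp) hb0 hc0
  · have hb := half_le_recip hq
    have hc := recip_le_half hr
    rw [max_eq_right (by linarith), max_eq_right (by linarith), max_eq_left (by linarith)]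
      at random
    convert random using 3
    ring
  · rw [one_mul]
    refine norm_idOp_le p q r (by positivity) fun T N h => ?_
    rcases le_total (recip q + recip r) 1 with h1 | h1
    · rw [min_eq_left h1]
      exact h.hsNorm_le_of_half_le_second ha0 (half_le_recip hq) hc0
    · rw [min_eq_right h1, Real.rpow_one]
      exact h.hsNorm_le_of_le_half ha0 hb0 hc0 (recip_le_half hr)
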